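/- A tree is a partial order with a least element in which the predecessors of each element are well-ordered and in which limits are unique (two elements of the same limit level with the same predecessors are equal). A \((\lambda,\mu)\)-tree is a tree in which every branch (maximal chain) has length (order type) less than \(\mu\) and every element has fewer than \(\lambda\) immediate successors. A \((\lambda,\mu)\)-tree \(T\) is semi-proper if \(T\) itself, turned upside down and regarded as a forcing notion, adds a \(\mu\)-branch (a branch of length \(\mu\)) to \(T\), preserves stationary subsets of \(\mu\) (every stationary \(S\subseteq\mu\) of the ground model remains stationary in the generic extension), and adds no sets of cardinality less than \(\mu\) (every set of ground model elements that lies in the generic extension and has there cardinality less than \(\mu\) belongs to the ground model). Let \(\kappa\) be an infinite cardinal. If \(\kappa=\theta^+=2^\theta\) for some cardinal \(\theta\), then there exists a semi-proper \((\kappa^{++},\kappa^+)\)-tree. In particular, under GCH there exists a semi-proper \((\kappa^{++},\kappa^+)\)-tree for every infinite successor cardinal \(\kappa\). -/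

import Mathlib

universe u

/-! ### Trees -/

/-- A tree: a partial order with a unique minimal element (if any) and unique limits, in which the
predecessors of each element are well-ordered. -/
structure IsTree (T : Type u) [PartialOrder T] : Prop where
  wellFounded : WellFoundedLT T
  isChain_Iio : ∀ x : T, IsChain (· ≤ ·) (Set.Iio x)
  /-- Two elements with the same predecessors and no immediate predecessor are equal. This covers
  the limit levels and the bottom level. -/
  unique_limit : ∀ x y : T, Set.Iio x = Set.Iio y → (∀ z, ¬ z ⋖ x) → x = y

/-- A set `B` of elements of a partial order has order type `o`. -/
def HasOrderType {T : Type u} [PartialOrder T] (B : Set T) (o : Ordinal.{u}) : Prop :=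
  Nonempty (B ≃o Set.Iio o)

/-- A `(lam, kap)`-tree: every branch has length less than `kap`, and every element has fewer
than `lam` immediate successors. -/
structure IsCardTree (T : Type u) [PartialOrder T] (lam kap : Cardinal.{u}) : Prop where
  isTree : IsTree T
  branch_lt : ∀ B : Set T, IsMaxChain (· ≤ ·) B → ∃ o < kap.ord, HasOrderType B o
  succ_lt : ∀ x : T, Cardinal.mk {y : T // x ⋖ y} < lam

/-! ### Forcing

A forcing notion is a nonempty preorder `P`, where `p ≤ q` means that `p` is stronger than `q`.
All statements about the generic extension that are needed here concern subsets of sets of the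
ground model. Such a statement is represented by the set of the conditions that force it. -/

/-- A statement of the forcing language, given as the predicate `p ⊩ φ` of `p`. -/
abbrev FStmt (P : Type*) := P → Prop

/-- A `P`-name for a subset of the ground model set `X`: a set of pairs `(x, p)`, where `x` stands
for its canonical name. -/
abbrev SetName (P X : Type*) := Set (X × P)

namespace FStmt

variable {P : Type*} [Preorder P] {X Y : Type*}

/-- A statement about elements of the ground model, evaluated there. -/
def ground (φ : Prop) : FStmt P := fun _ => φ

/-- `x ∈ A`: it is dense below `p` to lie below some `s` with `(x, s) ∈ A`. -/
def mem (x : X) (A : SetName P X) : FStmt P :=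
  fun p => ∀ q ≤ p, ∃ r ≤ q, ∃ s, r ≤ s ∧ (x, s) ∈ A

/-- Conjunction. -/
def and (φ ψ : FStmt P) : FStmt P := fun p => φ p ∧ ψ p

/-- Implication. -/
def imp (φ ψ : FStmt P) : FStmt P := fun p => ∀ q ≤ p, φ q → ψ q

/-- Equivalence. -/
def iff (φ ψ : FStmt P) : FStmt P := and (imp φ ψ) (imp ψ φ)

/-- Universal quantification over the elements of a ground model set, or over names. -/
def all {ι : Sort*} (φ : ι → FStmt P) : FStmt P := fun p => ∀ i, φ i p

/-- Existential quantification over the elements of a ground model set, or over names. -/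
def ex {ι : Sort*} (φ : ι → FStmt P) : FStmt P := fun p => ∀ q ≤ p, ∃ r ≤ q, ∃ i, φ i r

/-- `φ` is forced by every condition. -/
def Forced (φ : FStmt P) : Prop := ∀ p, φ p

/-- `F` is a function from `X` onto `A`. -/
def isSurj (F : SetName P (X × Y)) (A : SetName P Y) : FStmt P :=
  and (all fun x => ex fun y => mem (x, y) F) <|
  and (all fun x => all fun y => all fun y' =>
      imp (mem (x, y) F) (imp (mem (x, y') F) (ground (y = y')))) <|
  all fun y => iff (mem y A) (ex fun x => mem (x, y) F)

/-- `F` is strictly increasing. -/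
def isStrictMono [Preorder X] [Preorder Y] (F : SetName P (X × Y)) : FStmt P :=
  all fun x => all fun x' => all fun y => all fun y' =>
    imp (ground (x < x')) (imp (mem (x, y) F) (imp (mem (x', y') F) (ground (y < y'))))

/-- `A` is an element of the ground model. -/
def isGround (A : SetName P X) : FStmt P :=
  ex fun B : Set X => all fun x => iff (mem x A) (ground (x ∈ B))

/-- `B` is a maximal chain. -/
def isBranch {T : Type*} [PartialOrder T] (B : SetName P T) : FStmt P :=
  and
    (all fun x => all fun y => imp (mem x B) (imp (mem y B) (ground (x ≤ y ∨ y ≤ x))))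
    (all fun x => imp (all fun y => imp (mem y B) (ground (x ≤ y ∨ y ≤ x))) (mem x B))

/-- `C` is cofinal in the well-order `X`, and contains each `d` that is the supremum of
`{c ∈ C | c < d}` and not the least element of `X`. -/
def isClub [LinearOrder X] (C : SetName P X) : FStmt P :=
  and
    (all fun a => ex fun c => and (mem c C) (ground (a ≤ c)))
    (all fun d => imp
      (and (ground (∃ b, b < d))
        (all fun b => imp (ground (b < d)) (ex fun c => and (mem c C) (ground (b < c ∧ c < d)))))
      (mem d C))

/-- The ground model set `S` is stationary in the well-order `X`. -/
def isStationary [LinearOrder X] (S : Set X) : FStmt P :=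
  all fun C : SetName P X => imp (isClub C) (ex fun a => and (mem a C) (ground (a ∈ S)))

end FStmt

section ForcingProperties

variable (P : Type u) [Preorder P]

/-- Forcing with `P` adds a `kap`-branch to `T`: a branch of order type `kap.ord`. -/
def AddsBranch (T : Type u) [PartialOrder T] (kap : Cardinal.{u}) : Prop :=
  FStmt.Forced (P := P) <|
    .ex fun B : SetName P T => .and (.isBranch B) <|
      .ex fun F : SetName P (Set.Iio kap.ord × T) => .and (.isSurj F B) (.isStrictMono F)

/-- Every stationary subset of `kap` remains stationary after forcing with `P`. -/
def PreservesStationary (kap : Cardinal.{u}) : Prop :=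
  ∀ S : Set (Set.Iio kap.ord), IsStationary S → FStmt.Forced (P := P) (.isStationary S)

/-- Forcing with `P` adds no sets of cardinality less than `kap`: every subset of the ground model
that is the image of an ordinal less than `kap.ord` belongs to the ground model. -/
def AddsNoSmallSets (kap : Cardinal.{u}) : Prop :=
  ∀ X : Type u, FStmt.Forced (P := P) <|
    .all fun A : SetName P X => .imp
      (.ex fun o : Set.Iio kap.ord => .ex fun F : SetName P (Set.Iio o.1 × X) => .isSurj F A)
      (.isGround A)

end ForcingProperties

/-- `T` is (strongly) semi-proper with respect to `kap`: `T` itself, turned upside down and regarded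
as a forcing notion, adds a `kap`-branch to `T`, preserves stationary subsets of `kap`, and adds no
sets of cardinality less than `kap`. -/
structure IsSemiProper (T : Type u) [PartialOrder T] (kap : Cardinal.{u}) : Prop where
  nonempty : Nonempty T
  addsBranch : AddsBranch Tᵒᵈ T kap
  preservesStationary : PreservesStationary Tᵒᵈ kap
  addsNoSmallSets : AddsNoSmallSets Tᵒᵈ kap

/-- There is a semi-proper `(lam, kap)`-tree. -/
def ExistsSemiProperTree (lam kap : Cardinal.{u}) : Prop :=
  ∃ (T : Type u) (_ : PartialOrder T), IsCardTree T lam kap ∧ IsSemiProper T kap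

/-- The generalized continuum hypothesis. -/
def GCH : Prop := ∀ mu : Cardinal.{u}, Cardinal.aleph0 ≤ mu → 2 ^ mu = Order.succ mu

-- Let κ = θ⁺ = 2^θ. Then κ is regular and uncountable with κ^{<κ} = κ; below, `K` has type κ and
-- `X` has type κ⁺. Club guessing (`exists_clubGuess`) gives sets `a δ` ⊆ δ, for δ < κ⁺ of
-- cofinality κ, such that every club of κ⁺ meets some `a δ` cofinally in δ. The tree consists of
-- the closed bounded E ⊆ κ⁺ with E ∩ `a δ` bounded in δ at each limit point δ of E of cofinality κ,
-- ordered by end-extension. The union of a chain of unbounded heights would be a club that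
-- contradicts guessing, so all branches are shorter than κ⁺. An immediate successor adds a single
-- point, so there are at most κ⁺ of them.
--
-- The forcing properties rest on `exists_closed_node`: given an extension function Φ and a
-- stationary S, some node q is closed under Φ cofinally below some δ ∈ S. It is the limit of a run
-- of moves below δ, and the obstacle is that, when δ has cofinality κ, the limit must meet `a δ`
-- boundedly. Each move is available in κ pairwise disjoint versions, while `a δ` has fewer than κ
-- elements below any ν < δ, so some version adds no element of `a δ`. Each move also jumps over a
-- point of `c δ`, so limit points created on the way are limit points of `c δ`, and `a δ` contains
-- none of these. As these choices depend on δ, δ must be closed under the growth of all runs at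
-- once; by κ^{<κ} = κ there are few enough (`exists_growth`).
--
-- With S the points of cofinality κ, this yields that κ dense open sets have dense intersection,
-- hence no new small sets and a generic branch of length κ⁺. With S an arbitrary stationary set, it
-- yields preservation of S.

universe v

open Cardinal Set

/-! ### Clubs and cofinality in a well-order of type κ⁺ -/

section WellOrder

variable {X : Type u} [LinearOrder X]

/-- `γ` is a limit point of `E` in a well-order. -/
def IsLim (E : Set X) (γ : X) : Prop :=
  (∃ b, b < γ) ∧ ∀ b < γ, ∃ c ∈ E, b < c ∧ c < γ

/-- Closed unbounded subsets of a well-order without a last element. -/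
structure IsClosedUnbdd (E : Set X) : Prop where
  closed : ∀ γ, IsLim E γ → γ ∈ E
  unbdd : ∀ b, ∃ c ∈ E, b < c

/-- `S` contains a closure point of each function. -/
def MeetsClosurePoints (S : Set X) : Prop :=
  ∀ m : X → X, ∃ δ ∈ S, (∃ b, b < δ) ∧ ∀ x < δ, m x < δ

/-- The points whose cofinality is at least the cardinality of `K`. -/
def largeCof (X K : Type u) [LinearOrder X] : Set X :=
  {δ | ∀ A : Set X, A ⊆ Iio δ → #A < #K → ∃ b < δ, ∀ a ∈ A, a < b}

theorem IsLim.mono {E F : Set X} {γ : X} (h : IsLim E γ) (hEF : ∀ x < γ, x ∈ E → x ∈ F) :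
    IsLim F γ :=
  ⟨h.1, fun b hb => by
    obtain ⟨c, hc, h1, h2⟩ := h.2 b hb
    exact ⟨c, hEF c h2 hc, h1, h2⟩⟩

theorem exists_least_strict_bound [WellFoundedLT X] {A : Set X} (h : ∃ b, ∀ a ∈ A, a < b) :
    ∃ δ, (∀ a ∈ A, a < δ) ∧ ∀ b < δ, ∃ a ∈ A, b ≤ a := by
  obtain ⟨δ, h1, h2⟩ := WellFounded.has_min (wellFounded_lt (α := X)) {b | ∀ a ∈ A, a < b} h
  refine ⟨δ, h1, fun b hb => ?_⟩
  have := mt (h2 b) (not_not.2 hb)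
  simpa using this

/-- The order type of `K` is a regular uncountable cardinal `κ` with `κ ^ μ = κ` for `μ < κ`, and
that of `X` is `κ⁺`. -/
structure RegularPair (X K : Type u) [LinearOrder X] [LinearOrder K] : Prop where
  bdd : ∀ A : Set X, #A ≤ #K → ∃ b, ∀ a ∈ A, a < b
  card_Iio : ∀ x : X, #(Iio x) ≤ #K
  bdd_index : ∀ A : Set K, #A < #K → ∃ b, ∀ a ∈ A, a < b
  card_Iio_index : ∀ k : K, #(Iio k) < #K
  uncountable : ℵ₀ < #K
  power : ∀ k : K, #K ^ #(Iio k) ≤ #K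

namespace RegularPair

variable {K : Type u} [LinearOrder K] (h : RegularPair X K)
include h

theorem nonempty_index : Nonempty K := by
  rw [← mk_ne_zero_iff]
  exact (aleph0_pos.trans h.uncountable).ne'

theorem exists_gt_index (k : K) : ∃ l, k < l := by
  obtain ⟨l, hl⟩ := h.bdd_index {k} (by simpa using one_lt_aleph0.trans h.uncountable)
  exact ⟨l, hl k rfl⟩

theorem exists_gt (x : X) : ∃ y, x < y := by
  obtain ⟨l, hl⟩ := h.bdd {x} (by simpa using (one_lt_aleph0.trans h.uncountable).le)
  exact ⟨l, hl x rfl⟩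

theorem bdd_range {ι : Type u} (hι : #ι ≤ #K) (f : ι → X) : ∃ b, ∀ i, f i < b := by
  obtain ⟨b, hb⟩ := h.bdd (range f) (mk_range_le.trans hι)
  exact ⟨b, fun i => hb _ ⟨i, rfl⟩⟩

theorem card_Iic_index (k : K) : #(Iic k) < #K := by
  obtain ⟨l, hl⟩ := h.exists_gt_index k
  exact (mk_le_mk_of_subset fun x (hx : x ≤ k) => hx.trans_lt hl).trans_lt (h.card_Iio_index l)

theorem card_Iic (x : X) : #(Iic x) ≤ #K := by
  obtain ⟨l, hl⟩ := h.exists_gt x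
  exact (mk_le_mk_of_subset fun y (hx : y ≤ x) => hx.trans_lt hl).trans (h.card_Iio l)

theorem exists_sequence [WellFoundedLT K] (G : X → X) (x₀ : X) :
    ∃ γ : K → X, ∀ i, x₀ < γ i ∧ ∀ j < i, γ j < γ i ∧ G (γ j) < γ i := by
  have key : ∀ (i : K) (f : ∀ j, j < i → X), ∃ b, x₀ < b ∧ ∀ j hj, f j hj < b ∧ G (f j hj) < b := by
    intro i f
    obtain ⟨b, hb⟩ := h.bdd_range (h.card_Iio_index i).le fun j : Iio i => f j.1 j.2
    obtain ⟨c, hc⟩ := h.bdd_range (h.card_Iio_index i).le fun j : Iio i => G (f j.1 j.2)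
    obtain ⟨d, hd⟩ := h.exists_gt x₀
    refine ⟨max (max b c) d, by simp [hd], fun j hj => ⟨?_, ?_⟩⟩
    · exact (hb ⟨j, hj⟩).trans_le (by simp)
    · exact (hc ⟨j, hj⟩).trans_le (by simp)
  choose F hF using key
  let γ : K → X := (wellFounded_lt (α := K)).fix F
  have hγ : ∀ i, γ i = F i fun j _ => γ j := fun i => WellFounded.fix_eq _ _ _
  refine ⟨γ, fun i => ?_⟩
  have := hF i fun j _ => γ j
  rw [← hγ] at this
  exact this

/-- The supremum of an increasing κ-sequence, each term of which exceeds `m` on everything up to the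
earlier terms, is a closure point; it has cofinality κ because κ is regular. -/
theorem largeCof_meetsClosurePoints [WellFoundedLT X] [WellFoundedLT K] :
    MeetsClosurePoints (largeCof X K) := by
  intro m
  have hM : ∀ x : X, ∃ b, ∀ y : Iic x, m y < b := fun x => h.bdd_range (h.card_Iic x) _
  choose M hM using hM
  obtain ⟨k₀⟩ := h.nonempty_index
  obtain ⟨x₀, -⟩ := h.bdd ∅ (by simp)
  obtain ⟨γ, hγ⟩ := h.exists_sequence M x₀
  obtain ⟨δ, h1, h2⟩ := exists_least_strict_bound (A := range γ) (h.bdd _ mk_range_le)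
  refine ⟨δ, fun A hA hc => ?_, ⟨γ k₀, h1 _ ⟨k₀, rfl⟩⟩, fun x hx => ?_⟩
  · have : ∀ a : A, ∃ k, a ≤ γ k := fun a => by simpa using h2 a (hA a.2)
    choose k hk using this
    obtain ⟨l, hl⟩ := h.bdd_index (range k) (mk_range_le.trans_lt hc)
    exact ⟨γ l, h1 _ ⟨l, rfl⟩, fun a ha =>
      (hk ⟨a, ha⟩).trans_lt ((hγ l).2 _ (hl _ ⟨_, rfl⟩)).1⟩
  · obtain ⟨_, ⟨k, rfl⟩, hk⟩ := h2 x hx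
    obtain ⟨l, hl⟩ := h.exists_gt_index k
    exact (hM (γ k) ⟨x, hk⟩).trans (((hγ l).2 k hl).2.trans (h1 _ ⟨l, rfl⟩))

theorem exists_surjection {x : X} (hx : ∃ b, b < x) : ∃ f : K → Iio x, Function.Surjective f := by
  obtain ⟨b, hb⟩ := hx
  have : Nonempty (Iio x) := ⟨⟨b, hb⟩⟩
  obtain ⟨g⟩ := (Cardinal.le_def _ _).1 (h.card_Iio x)
  exact ⟨Function.invFun g, Function.invFun_surjective g.injective⟩

end RegularPair

/-- Without a greatest element, the supremum of `E ∩ Iic y` would be a limit point of `E`, hence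
itself in that set. -/
theorem IsClosedUnbdd.exists_isGreatest [WellFoundedLT X] {E : Set X} (hE : IsClosedUnbdd E) {x y : X}
    (hx : x ∈ E) (hxy : x ≤ y) : ∃ z, IsGreatest (E ∩ Iic y) z := by
  obtain ⟨b, hb⟩ := hE.unbdd y
  obtain ⟨δ, h1, h2⟩ := exists_least_strict_bound (A := E ∩ Iic y)
    ⟨b, fun a ha => lt_of_le_of_lt ha.2 hb.2⟩
  by_contra hcon
  push Not at hcon
  have hcon' : ∀ z ∈ E ∩ Iic y, ∃ w ∈ E ∩ Iic y, z < w := by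
    intro z hz
    have := hcon z
    simp only [IsGreatest, mem_upperBounds, not_and, not_forall, not_le] at this
    obtain ⟨w, hw, hzw⟩ := this hz
    exact ⟨w, hw, hzw⟩
  have hδ : δ ∈ E := hE.closed δ ⟨⟨x, h1 x ⟨hx, hxy⟩⟩, fun b hb => by
    obtain ⟨a, ha, hba⟩ := h2 b hb
    obtain ⟨w, hw, haw⟩ := hcon' a ha
    exact ⟨w, hw.1, hba.trans_lt haw, h1 w hw⟩⟩
  have : ¬ δ ≤ y := fun hle => lt_irrefl _ (h1 δ ⟨hδ, hle⟩)
  obtain ⟨a, ha, hya⟩ := h2 y (not_le.1 this)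
  obtain ⟨w, hw, haw⟩ := hcon' a ha
  exact absurd hw.2 (not_le.2 (hya.trans_lt haw))

theorem IsClosedUnbdd.iInter_nat [WellFoundedLT X] {K : Type u} [LinearOrder K] (h : RegularPair X K)
    {E : ℕ → Set X} (hE : ∀ n, IsClosedUnbdd (E n)) : IsClosedUnbdd (⋂ n, E n) := by
  refine ⟨fun γ hγ => mem_iInter.2 fun n => (hE n).closed γ
    (hγ.mono fun x _ hx => mem_iInter.1 hx n), fun b => ?_⟩
  have hnx : ∀ x : X, ∃ y, ∀ n, ∃ c ∈ E n, x < c ∧ c < y := by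
    intro x
    choose f hf using fun n => (hE n).unbdd x
    obtain ⟨y, hy⟩ := h.bdd (range f) ((countable_range f).le_aleph0.trans h.uncountable.le)
    exact ⟨y, fun n => ⟨f n, (hf n).1, (hf n).2, hy _ ⟨n, rfl⟩⟩⟩
  choose g hg using hnx
  have hlt : ∀ x, x < g x := fun x => by
    obtain ⟨c, -, h1, h2⟩ := hg x 0
    exact h1.trans h2
  let s : ℕ → X := fun n => g^[n] b
  have hs : ∀ n, s (n + 1) = g (s n) := fun n => Function.iterate_succ_apply' _ _ _
  obtain ⟨δ, h1, h2⟩ := exists_least_strict_bound (A := range s)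
    (h.bdd (range s) ((countable_range s).le_aleph0.trans h.uncountable.le))
  refine ⟨δ, mem_iInter.2 fun n => (hE n).closed δ ⟨⟨b, h1 _ ⟨0, rfl⟩⟩, fun y hy => ?_⟩, h1 _ ⟨0, rfl⟩⟩
  obtain ⟨_, ⟨k, rfl⟩, hk⟩ := h2 y hy
  obtain ⟨c, hc, hc1, hc2⟩ := hg (s k) n
  exact ⟨c, hc, hk.trans_lt hc1, hc2.trans (hs k ▸ h1 _ ⟨k + 1, rfl⟩)⟩

theorem IsClosedUnbdd.inter [WellFoundedLT X] {K : Type u} [LinearOrder K] (h : RegularPair X K)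
    {E F : Set X} (hE : IsClosedUnbdd E) (hF : IsClosedUnbdd F) : IsClosedUnbdd (E ∩ F) := by
  have := IsClosedUnbdd.iInter_nat h (E := fun n => if n = 0 then E else F) (fun n => by
    split_ifs <;> assumption)
  convert this using 1
  ext x
  simp only [mem_inter_iff, mem_iInter]
  refine ⟨fun hx n => by split_ifs; exacts [hx.1, hx.2], fun hx => ⟨by simpa using hx 0, by simpa using hx 1⟩⟩

/-- Points of `S` meet closed unbounded sets cofinally below some point of `S`. -/
theorem MeetsClosurePoints.exists_lim {S E : Set X}
    (hS : MeetsClosurePoints S) (hE : IsClosedUnbdd E) :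
    ∃ δ ∈ S, IsLim (S ∩ E) δ := by
  have hSE : ∀ b, ∃ c ∈ S ∩ E, b < c := by
    intro b
    choose f hf using hE.unbdd
    obtain ⟨δ, hδ, ⟨y, hy⟩, hcl⟩ := hS fun x => f (max b x)
    have hlt : ∀ x, max b x < f (max b x) := fun x => (hf _).2
    have hb : b < δ := (le_max_left b y).trans_lt ((hlt y).trans (hcl y hy))
    exact ⟨δ, ⟨hδ, hE.closed δ ⟨⟨b, hb⟩, fun x hx => ⟨f (max b x), (hf _).1,
      (le_max_right b x).trans_lt (hlt x), hcl x hx⟩⟩⟩, hb⟩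
  choose g hg using hSE
  obtain ⟨δ, hδ, hne, hcl⟩ := hS g
  exact ⟨δ, hδ, hne, fun b hb => ⟨g b, (hg b).1, (hg b).2, hcl b hb⟩⟩

end WellOrder

/-! ### Club guessing at points of cofinality κ -/

section WellOrder

/-- Sets `a δ` and `c δ`, for the points `δ` of large cofinality, such that `a δ` has few elements
below each `ν < δ` and contains no limit point of the unbounded subset `c δ` of `δ`, while each
closed unbounded set meets some `a δ` unboundedly often. -/
structure ClubGuess (X K : Type u) [LinearOrder X] (a c : X → Set X) : Prop where
  lt : ∀ δ ∈ largeCof X K, ∀ y ∈ a δ, y < δ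
  unbdd : ∀ δ ∈ largeCof X K, ∀ b < δ, ∃ y ∈ c δ, b ≤ y ∧ y < δ
  card_lt : ∀ δ ∈ largeCof X K, ∀ ν < δ, #(a δ ∩ Iio ν : Set X) < #K
  not_isLim : ∀ δ ∈ largeCof X K, ∀ y ∈ a δ, ¬ IsLim (c δ) y
  guess : ∀ E : Set X, IsClosedUnbdd E → ∃ δ ∈ largeCof X K, IsLim E δ ∧
    ∀ b < δ, ∃ y ∈ E ∩ a δ, b < y

variable {X K : Type u} [LinearOrder X] [LinearOrder K]

/-- The greatest elements of `E` up to `e k`, if they lie above some bound of all previous values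
of `e`. -/
def guessSet (e : K → X) (E : Set X) : Set X :=
  {y | ∃ k, IsGreatest (E ∩ Iic (e k)) y ∧ ∃ b < y, ∀ i < k, e i < b}

variable [WellFoundedLT K]

theorem RegularPair.exists_cofinal (h : RegularPair X K) {δ : X} (hδ : δ ∈ largeCof X K) :
    ∃ e : K → X, (∀ k, e k < δ) ∧ StrictMono e ∧ ∀ b < δ, ∃ k, b ≤ e k := by
  have hne : ∃ b, b < δ := by
    obtain ⟨b, hb, -⟩ := hδ ∅ (empty_subset _) (by simpa using aleph0_pos.trans h.uncountable)
    exact ⟨b, hb⟩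
  obtain ⟨f, hf⟩ := h.exists_surjection hne
  have key : ∀ (k : K) (g : ∀ j, j < k → Iio δ), ∃ b : Iio δ, f k ≤ b ∧ ∀ j hj, g j hj < b := by
    intro k g
    obtain ⟨b, hb, hb'⟩ := hδ (range fun j : Iio k => (g j.1 j.2 : X))
      (by rintro _ ⟨j, rfl⟩; exact (g j.1 j.2).2) (mk_range_le.trans_lt (h.card_Iio_index k))
    exact ⟨max (f k) ⟨b, hb⟩, le_max_left _ _, fun j hj =>
      lt_max_of_lt_right (hb' _ ⟨⟨j, hj⟩, rfl⟩)⟩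
  choose F hF using key
  let e : K → Iio δ := (wellFounded_lt (α := K)).fix F
  have he : ∀ k, e k = F k fun j _ => e j := fun i => WellFounded.fix_eq _ _ _
  have he' : ∀ k, f k ≤ e k ∧ ∀ j < k, e j < e k := fun k => by
    have := hF k fun j _ => e j
    rw [← he] at this
    exact this
  refine ⟨fun k => e k, fun k => (e k).2, fun j k hjk => (he' k).2 j hjk, fun b hb => ?_⟩
  obtain ⟨k, hk⟩ := hf ⟨b, hb⟩
  refine ⟨k, ?_⟩
  have := (he' k).1
  rw [hk] at this
  exact this

/-- Shelah's argument: if every candidate built from a club fails, the counterexamples give a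
decreasing ω-sequence of clubs `E n`. At a suitable δ, the greatest elements of `E n` up to a point
`e δ k` decrease with n, hence stabilise, and the stable value belongs to the guess that it was
supposed to escape. -/
theorem exists_clubGuess [WellFoundedLT X] (h : RegularPair X K) : ∃ a c : X → Set X, ClubGuess X K a c := by
  have hS := h.largeCof_meetsClosurePoints
  have : ∀ δ : X, ∃ e : K → X, δ ∈ largeCof X K →
      (∀ k, e k < δ) ∧ StrictMono e ∧ ∀ b < δ, ∃ k, b ≤ e k := by
    intro δ
    by_cases hδ : δ ∈ largeCof X K
    · obtain ⟨e, he⟩ := h.exists_cofinal hδ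
      exact ⟨e, fun _ => he⟩
    · exact ⟨fun _ => δ, fun h => absurd h hδ⟩
  choose e he using this
  by_contra hcon
  push Not at hcon
  -- If no `E'` works for `E`, then `guessSet (e δ) E` guesses: a club `F` is tested through `F ∩
  -- E`.
  have step : ∀ E : Set X, IsClosedUnbdd E → ∃ E', IsClosedUnbdd E' ∧ E' ⊆ E ∧
      ∀ δ ∈ largeCof X K, IsLim E' δ → ∃ b < δ, ∀ y ∈ E' ∩ guessSet (e δ) E, y ≤ b := by
    intro E hE
    have hno := hcon (fun δ => guessSet (e δ) E) fun δ => range (e δ)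
    by_contra hcon'
    push Not at hcon'
    refine hno ⟨?_, ?_, ?_, ?_, ?_⟩
    · rintro δ hδ y ⟨k, hk, -⟩
      exact lt_of_le_of_lt hk.1.2 ((he δ hδ).1 k)
    · intro δ hδ b hb
      obtain ⟨k, hk⟩ := (he δ hδ).2.2 b hb
      exact ⟨e δ k, ⟨k, rfl⟩, hk, (he δ hδ).1 k⟩
    · intro δ hδ ν hν
      obtain ⟨l, hl⟩ := (he δ hδ).2.2 ν hν
      have hex : ∀ y : (guessSet (e δ) E ∩ Iio ν : Set X), ∃ k : Iic l,
          IsGreatest (E ∩ Iic (e δ k)) y := by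
        rintro ⟨y, ⟨k, hk, b, hb, hkb⟩, hy⟩
        refine ⟨⟨k, not_lt.1 fun hlk => ?_⟩, hk⟩
        exact lt_irrefl _ (hl.trans_lt ((hkb l hlk).trans (hb.trans hy)))
      choose g hg using hex
      refine (mk_le_of_injective (f := g) fun y z hyz => ?_).trans_lt (h.card_Iic_index l)
      exact Subtype.ext ((hg y).unique (hyz ▸ hg z))
    · rintro δ hδ y ⟨k, hk, b, hb, hkb⟩ hlim
      obtain ⟨_, ⟨i, rfl⟩, h1, h2⟩ := hlim.2 b hb
      have hki : k ≤ i := not_lt.1 fun hik => lt_asymm h1 (hkb i hik)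
      exact absurd (hk.1.2.trans ((he δ hδ).2.1.monotone hki)) (not_le.2 h2)
    · intro F hF
      obtain ⟨δ, hδ, hlim, hb⟩ := hcon' (F ∩ E) (hF.inter h hE) inter_subset_right
      refine ⟨δ, hδ, hlim.mono fun x _ hx => hx.1, fun b hbδ => ?_⟩
      obtain ⟨y, hy, hby⟩ := hb b hbδ
      exact ⟨y, ⟨hy.1.1, hy.2⟩, hby⟩
  choose! next hnext using step
  have huniv : IsClosedUnbdd (univ : Set X) :=
    ⟨fun _ _ => mem_univ _, fun b => by simpa using h.exists_gt b⟩
  let E : ℕ → Set X := fun n => next^[n] univ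
  have hsucc : ∀ n, E (n + 1) = next (E n) := fun n => Function.iterate_succ_apply' _ _ _
  have hE : ∀ n, IsClosedUnbdd (E n) := by
    intro n
    induction n with
    | zero => exact huniv
    | succ n ih => rw [hsucc]; exact (hnext _ ih).1
  obtain ⟨δ, hδ, hlim⟩ := hS.exists_lim (IsClosedUnbdd.iInter_nat h hE)
  have hb : ∀ n, ∃ b < δ, ∀ y ∈ E (n + 1) ∩ guessSet (e δ) (E n), y ≤ b := by
    intro n
    rw [hsucc]
    refine (hnext _ (hE n)).2.2 δ hδ ?_
    rw [← hsucc]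
    exact hlim.mono fun x _ hx => mem_iInter.1 hx.2 _
  choose b hbδ hb using hb
  obtain ⟨b', hb'δ, hb'⟩ := hδ (range b) (by rintro _ ⟨n, rfl⟩; exact hbδ n)
    ((countable_range b).le_aleph0.trans_lt h.uncountable)
  obtain ⟨x, ⟨hxS, hxE⟩, hbx, hxδ⟩ := hlim.2 b' hb'δ
  -- Since `x` has cofinality κ, the values of `e δ` before the first one reaching `x` are bounded
  -- by some `d < x`. This is the gap required in `guessSet`.
  obtain ⟨k, hk, hkmin⟩ := WellFounded.has_min (wellFounded_lt (α := K)) {k | x ≤ e δ k}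
    ((he δ hδ).2.2 x hxδ)
  obtain ⟨d, hd, hkd⟩ := hxS (range fun i : Iio k => e δ i)
    (by rintro _ ⟨i, rfl⟩; exact not_le.1 fun hle => hkmin i hle i.2)
    (mk_range_le.trans_lt (h.card_Iio_index k))
  have hy : ∀ n, ∃ y, IsGreatest (E n ∩ Iic (e δ k)) y := fun n =>
    (hE n).exists_isGreatest (mem_iInter.1 hxE n) hk
  choose y hy using hy
  have hxy : ∀ n, x ≤ y n := fun n => (hy n).2 ⟨mem_iInter.1 hxE n, hk⟩
  have hsub : ∀ n, E (n + 1) ⊆ E n := fun n => by rw [hsucc]; exact (hnext _ (hE n)).2.1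
  obtain ⟨n, hn⟩ : ∃ n, y n ≤ y (n + 1) := by
    by_contra hdec
    push Not at hdec
    exact (wellFounded_iff_isEmpty_descending_chain.1 (wellFounded_lt (α := X))).elim ⟨y, hdec⟩
  have hle : y (n + 1) ≤ y n := (hy n).2 ⟨hsub n (hy (n + 1)).1.1, (hy (n + 1)).1.2⟩
  have heq := le_antisymm hn hle
  have := hb n (y n) ⟨heq ▸ (hy (n + 1)).1.1, k, hy n, d, hd.trans_le (hxy n),
    fun i hi => hkd _ ⟨⟨i, hi⟩, rfl⟩⟩
  exact absurd ((hb' _ ⟨n, rfl⟩).trans (hbx.trans_le (hxy n))) (not_lt.2 this)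

end WellOrder

/-! ### The tree of closed bounded sets under end-extension -/

section Nodes

variable {X K : Type u} [LinearOrder X] {a : X → Set X}

/-- `E` is closed and bounded, and meets `a δ` boundedly for each limit point `δ` of large
cofinality. -/
structure IsNode (K : Type u) (a : X → Set X) (E : Set X) : Prop where
  closed : ∀ γ, IsLim E γ → γ ∈ E
  bdd : ∃ b, ∀ x ∈ E, x < b
  avoid : ∀ δ ∈ largeCof X K, IsLim E δ → ∃ b < δ, ∀ y ∈ E, y ∈ a δ → y < δ → y ≤ b

/-- The tree of the sets satisfying `IsNode`, ordered by end-extension. -/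
def Node (K : Type u) (a : X → Set X) : Type u := {E : Set X // IsNode K a E}

namespace Node

instance : Membership X (Node K a) := ⟨fun E x => x ∈ E.1⟩

/-- The node with the given underlying set. -/
def mk (E : Set X) (hE : IsNode K a E) : Node K a := ⟨E, hE⟩

theorem ext_mem {E F : Node K a} (h : ∀ x, x ∈ E ↔ x ∈ F) : E = F := Subtype.ext (Set.ext h)

instance : PartialOrder (Node K a) where
  le E F := ∃ b, ∀ x, x ∈ E ↔ x ∈ F ∧ x < b
  le_refl E := by
    obtain ⟨b, hb⟩ := E.2.bdd
    exact ⟨b, fun x => ⟨fun hx => ⟨hx, hb x hx⟩, fun hx => hx.1⟩⟩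
  le_trans E F G := by
    rintro ⟨b, hb⟩ ⟨c, hc⟩
    refine ⟨min b c, fun x => ?_⟩
    rw [hb, hc, lt_min_iff]
    tauto
  le_antisymm E F := by
    rintro ⟨b, hb⟩ ⟨c, hc⟩
    exact ext_mem fun x => ⟨fun hx => ((hb x).1 hx).1, fun hx => ((hc x).1 hx).1⟩

theorem mem_of_le {E F : Node K a} (h : E ≤ F) {x : X} (hx : x ∈ E) : x ∈ F := by
  obtain ⟨b, hb⟩ := h
  exact ((hb x).1 hx).1

theorem mem_of_le_of_le {E F : Node K a} (h : E ≤ F) {x y : X} (hx : x ∈ F) (hy : y ∈ E)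
    (hxy : x ≤ y) : x ∈ E := by
  obtain ⟨b, hb⟩ := h
  exact (hb x).2 ⟨hx, hxy.trans_lt ((hb y).1 hy).2⟩

variable [WellFoundedLT X]

theorem exists_bound (E : Node K a) : ∃ δ, (∀ x ∈ E, x < δ) ∧ ∀ b < δ, ∃ x ∈ E, b ≤ x :=
  exists_least_strict_bound E.2.bdd

/-- The least strict upper bound of `E`. -/
noncomputable def height (E : Node K a) : X := E.exists_bound.choose

theorem lt_height {E : Node K a} {x : X} (hx : x ∈ E) : x < E.height :=
  E.exists_bound.choose_spec.1 x hx

theorem exists_of_lt_height {E : Node K a} {b : X} (hb : b < E.height) : ∃ x ∈ E, b ≤ x :=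
  E.exists_bound.choose_spec.2 b hb

theorem height_le {E : Node K a} {b : X} (hb : ∀ x ∈ E, x < b) : E.height ≤ b := by
  by_contra hcon
  obtain ⟨x, hx, hbx⟩ := exists_of_lt_height (not_le.1 hcon)
  exact absurd (hb x hx) (not_lt.2 hbx)

theorem le_iff {E F : Node K a} : E ≤ F ↔ ∀ x, x ∈ E ↔ x ∈ F ∧ x < E.height := by
  refine ⟨fun h x => ⟨fun hx => ⟨mem_of_le h hx, lt_height hx⟩, fun hx => ?_⟩, fun h => ⟨_, h⟩⟩
  obtain ⟨y, hy, hxy⟩ := exists_of_lt_height hx.2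
  exact mem_of_le_of_le h hx.1 hy hxy

theorem height_mono {E F : Node K a} (h : E ≤ F) : E.height ≤ F.height :=
  height_le fun _ hx => lt_height (mem_of_le h hx)

theorem height_strictMono {E F : Node K a} (h : E < F) : E.height < F.height := by
  refine lt_of_le_of_ne (height_mono h.le) fun heq => h.ne (ext_mem fun x => ?_)
  rw [le_iff.1 h.le x, heq]
  exact ⟨fun hx => hx.1, fun hx => ⟨hx, lt_height hx⟩⟩

theorem le_of_height_le {E F G : Node K a} (hE : E ≤ G) (hF : F ≤ G) (h : E.height ≤ F.height) :
    E ≤ F := by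
  refine le_iff.2 fun x => ?_
  rw [le_iff.1 hE, le_iff.1 hF]
  exact ⟨fun hx => ⟨⟨hx.1, hx.2.trans_le h⟩, hx.2⟩, fun hx => ⟨hx.1.1, hx.2⟩⟩

theorem le_total_of_le {E F G : Node K a} (hE : E ≤ G) (hF : F ≤ G) : E ≤ F ∨ F ≤ E :=
  (le_total E.height F.height).imp (le_of_height_le hE hF) (le_of_height_le hF hE)

instance : WellFoundedLT (Node K a) :=
  ⟨Subrelation.wf (fun h => height_strictMono h) (InvImage.wf height (wellFounded_lt (α := X)))⟩

omit [WellFoundedLT X] in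
theorem isLim_insert {E : Set X} {γ y : X} (hE : ∀ x ∈ E, x < γ) (h : IsLim (insert γ E) y)
    (hclosed : IsLim E y → y ∈ E) : y ∈ insert γ E ∧ IsLim E y := by
  rcases lt_or_ge γ y with hlt | hge
  · obtain ⟨c, hc, h1, -⟩ := h.2 γ hlt
    rcases hc with rfl | hc
    · exact absurd h1 (lt_irrefl _)
    · exact absurd h1 (hE c hc).not_gt
  · have : IsLim E y := h.mono fun x hx hxE => hxE.resolve_left (hx.trans_le hge).ne
    exact ⟨Or.inr (hclosed this), this⟩

/-- `E` with the further element `γ`. -/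
def snoc (E : Node K a) (γ : X) (hγ : E.height ≤ γ) (hX : ∃ b, γ < b) : Node K a :=
  ⟨insert γ E.1, by
    have hlt : ∀ x ∈ E.1, x < γ := fun x hx => (lt_height hx).trans_le hγ
    refine ⟨fun y hy => (isLim_insert hlt hy (E.2.closed y)).1, ?_, fun δ hδ hlim => ?_⟩
    · obtain ⟨b, hb⟩ := hX
      refine ⟨b, fun x hx => ?_⟩
      rcases hx with rfl | hx
      exacts [hb, (hlt x hx).trans hb]
    · have hl := (isLim_insert hlt hlim (E.2.closed δ)).2
      obtain ⟨b, hb, hb'⟩ := E.2.avoid δ hδ hl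
      have hδγ : δ < γ := hlt δ (E.2.closed δ hl)
      refine ⟨b, hb, fun y hy hya hyδ => ?_⟩
      rcases hy with rfl | hyE
      exacts [absurd hδγ hyδ.not_gt, hb' y hyE hya hyδ]⟩

theorem mem_snoc {E : Node K a} {γ : X} {hγ : E.height ≤ γ} {hX : ∃ b, γ < b} {x : X} :
    x ∈ E.snoc γ hγ hX ↔ x = γ ∨ x ∈ E := Iff.rfl

theorem lt_snoc (E : Node K a) (γ : X) (hγ : E.height ≤ γ) (hX : ∃ b, γ < b) :
    E < E.snoc γ hγ hX := by
  refine lt_of_le_of_ne (le_iff.2 fun x => ?_) fun heq => ?_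
  · rw [mem_snoc]
    exact ⟨fun hx => ⟨Or.inr hx, lt_height hx⟩,
      fun hx => hx.1.resolve_left (hx.2.trans_le hγ).ne⟩
  · have : γ ∈ E := by
      rw [heq]
      exact Or.inl rfl
    exact absurd hγ (not_le.2 (lt_height this))

omit [WellFoundedLT X] in
/-- The elements of `E` below `x`. -/
def init (E : Node K a) (x : X) (hx : ¬ IsLim E.1 x) : Node K a :=
  ⟨E.1 ∩ Iio x, by
    have hlim : ∀ γ, IsLim (E.1 ∩ Iio x) γ → IsLim E.1 γ ∧ γ < x := by
      intro γ hγ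
      have h1 : IsLim E.1 γ := hγ.mono fun _ _ hy => hy.1
      refine ⟨h1, lt_of_le_of_ne (not_lt.1 fun hlt => ?_) ?_⟩
      · obtain ⟨c, hc, hxc, -⟩ := hγ.2 x hlt
        exact absurd hc.2 hxc.not_gt
      · rintro rfl
        exact hx h1
    refine ⟨fun γ hγ => ⟨E.2.closed γ (hlim γ hγ).1, (hlim γ hγ).2⟩, ⟨x, fun y hy => hy.2⟩,
      fun δ hδ hl => ?_⟩
    obtain ⟨b, hb, hb'⟩ := E.2.avoid δ hδ (hlim δ hl).1
    exact ⟨b, hb, fun y hy => hb' y hy.1⟩⟩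

omit [WellFoundedLT X] in
theorem mem_init {E : Node K a} {x : X} {hx : ¬ IsLim E.1 x} {y : X} :
    y ∈ E.init x hx ↔ y ∈ E ∧ y < x := Iff.rfl

omit [WellFoundedLT X] in
theorem init_le (E : Node K a) (x : X) (hx : ¬ IsLim E.1 x) : E.init x hx ≤ E :=
  ⟨x, fun _ => Iff.rfl⟩

/-- The elements of `E` up to a given element of `E` form a node. -/
theorem exists_trunc {E : Node K a} {x : X} (hx : x ∈ E) :
    ∃ F ≤ E, ∀ y, y ∈ F ↔ y ∈ E ∧ y ≤ x := by
  obtain ⟨s, hs, hs'⟩ := WellFounded.has_min (wellFounded_lt (α := X)) (Ioi x)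
    ⟨_, lt_height hx⟩
  have hlim : ¬ IsLim E.1 s := fun h => by
    obtain ⟨c, -, h1, h2⟩ := h.2 x hs
    exact hs' c h1 h2
  have hiff : ∀ y, y < s ↔ y ≤ x := fun y =>
    ⟨fun h => not_lt.1 fun hxy => hs' y hxy h, fun h => h.trans_lt hs⟩
  exact ⟨E.init s hlim, init_le _ _ _, fun y => by rw [mem_init, hiff]⟩

omit [WellFoundedLT X] in
/-- The empty node. -/
def empty (K : Type u) (a : X → Set X) (x : X) : Node K a :=
  ⟨∅, by
    have hno : ∀ γ : X, ¬ IsLim ∅ γ := fun γ ⟨⟨b, hb⟩, h⟩ => by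
      obtain ⟨c, hc, -⟩ := h b hb
      exact hc
    exact ⟨fun γ h => (hno γ h).elim, ⟨x, fun _ h => h.elim⟩, fun δ _ h => (hno δ h).elim⟩⟩

/-- A non-maximal point of `E` lies in a proper truncation of `E`. A maximal point that is a limit
of `E` is recovered from closedness of `F`; one that is not a limit would make `E` an immediate
successor. -/
theorem subset_of_Iio_eq {E F : Node K a} (hEF : Iio E = Iio F) (hE : ∀ Z, ¬ Z ⋖ E) {x : X}
    (hx : x ∈ E) : x ∈ F := by
  have hnonmax : ∀ z ∈ E, (∃ y ∈ E, z < y) → z ∈ F := by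
    rintro z hz ⟨y, hy, hzy⟩
    obtain ⟨G, hG, hG'⟩ := exists_trunc hz
    have hlt : G < E := lt_of_le_of_ne hG fun heq => by
      rw [← heq, hG'] at hy
      exact absurd hy.2 hzy.not_ge
    exact mem_of_le (le_of_lt (show G ∈ Iio F from hEF ▸ hlt)) ((hG' z).2 ⟨hz, le_rfl⟩)
  by_cases hmax : ∃ y ∈ E, x < y
  · exact hnonmax x hx hmax
  push Not at hmax
  by_cases hlim : IsLim E.1 x
  · exact F.2.closed x (hlim.mono fun y hy hyE => hnonmax y hyE ⟨x, hx, hy⟩)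
  refine absurd ⟨lt_of_le_of_ne (init_le E x hlim) fun heq => ?_, fun W hW hWE => ?_⟩
    (hE (E.init x hlim))
  · rw [← heq] at hx
    exact lt_irrefl _ hx.2
  · have hxW : x ∈ W := by
      by_contra hxW
      refine hW.not_ge ⟨x, fun y => ?_⟩
      rw [mem_init]
      refine ⟨fun hy => ⟨⟨mem_of_le hWE.le hy, ?_⟩, ?_⟩, fun hy => mem_of_le hW.le hy.1⟩ <;>
      exact lt_of_le_of_ne (hmax y (mem_of_le hWE.le hy)) (by rintro rfl; exact hxW hy)
    refine hWE.not_ge (le_iff.2 fun y => ⟨fun hy => ⟨?_, lt_height hy⟩,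
      fun hy => mem_of_le hWE.le hy.1⟩)
    exact mem_of_le_of_le hWE.le hy hxW (hmax y hy)

theorem isTree : IsTree (Node K a) where
  wellFounded := inferInstance
  isChain_Iio G := fun _ hE _ hF _ => le_total_of_le (le_of_lt hE) (le_of_lt hF)
  unique_limit E F hEF hE := by
    have hcov : ∀ {G H : Node K a}, Iio G = Iio H → ∀ Z, Z ⋖ G → Z ⋖ H := by
      intro G H hGH Z hZ
      exact ⟨(hGH ▸ hZ.1 : Z ∈ Iio H), fun W hW hWH => hZ.2 hW (hGH ▸ hWH : W ∈ Iio G)⟩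
    exact ext_mem fun x => ⟨subset_of_Iio_eq hEF hE,
      subset_of_Iio_eq hEF.symm fun Z hZ => hE Z (hcov hEF.symm Z hZ)⟩

theorem mk_covBy_le (E : Node K a) : #{F : Node K a // E ⋖ F} ≤ #X := by
  have : ∀ F : {F : Node K a // E ⋖ F}, ∃ γ, ∀ x, x ∈ F.1 ↔ x = γ ∨ x ∈ E := by
    rintro ⟨F, hF⟩
    have hex : {x | x ∈ F ∧ x ∉ E}.Nonempty := by
      by_contra hcon
      refine hF.1.ne (ext_mem fun x => ⟨mem_of_le hF.1.le, fun hx => ?_⟩)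
      by_contra hxE
      exact hcon ⟨x, hx, hxE⟩
    obtain ⟨γ, ⟨hγF, hγE⟩, hmin⟩ := WellFounded.has_min (wellFounded_lt (α := X)) _ hex
    -- Truncating `F` at its least new point already properly extends `E`, so it is all of `F`.
    obtain ⟨W, hW, hW'⟩ := exists_trunc hγF
    have hγ : E.height ≤ γ := not_lt.1 fun hlt => hγE ((le_iff.1 hF.1.le γ).2 ⟨hγF, hlt⟩)
    have hγW : γ ∈ W := (hW' γ).2 ⟨hγF, le_rfl⟩
    have hEW : E < W := lt_of_le_of_ne (le_of_height_le hF.1.le hW (hγ.trans (lt_height hγW).le))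
      fun heq => hγE (heq ▸ hγW)
    have hWF : W = F := hW.eq_of_not_lt fun hlt => hF.2 hEW hlt
    refine ⟨γ, fun x => ⟨fun hx => ?_, ?_⟩⟩
    · refine or_iff_not_imp_right.2 fun hxE => ?_
      have h1 : x ≤ γ := ((hW' x).1 (hWF.symm ▸ hx)).2
      exact le_antisymm h1 (not_lt.1 fun hlt => hmin x ⟨hx, hxE⟩ hlt)
    · rintro (rfl | hx)
      exacts [hγF, mem_of_le hF.1.le hx]
  choose g hg using this
  refine mk_le_of_injective (f := g) fun F G hFG => Subtype.ext (ext_mem fun x => ?_)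
  rw [hg, hg, hFG]

/-- Otherwise the union of the chain is a club. Where guessing succeeds at δ, a member of the chain
reaching beyond δ violates its own condition `avoid`. -/
theorem exists_height_le_of_isChain [LinearOrder K] {c : X → Set X} (h : RegularPair X K)
    (hg : ClubGuess X K a c) {B : Set (Node K a)} (hB : IsChain (· ≤ ·) B) :
    ∃ b, ∀ E ∈ B, E.height ≤ b := by
  by_contra hcon
  push Not at hcon
  have hbig : ∀ b, ∃ E ∈ B, ∃ x ∈ E, b < x := by
    intro b
    obtain ⟨b', hb'⟩ := h.exists_gt b
    obtain ⟨E, hE, hbE⟩ := hcon b'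
    obtain ⟨x, hx, hbx⟩ := exists_of_lt_height hbE
    exact ⟨E, hE, x, hx, hb'.trans_le hbx⟩
  let U : Set X := {x | ∃ E ∈ B, x ∈ E}
  have hUmem : ∀ E ∈ B, ∀ x ∈ E, ∀ y ∈ U, y ≤ x → y ∈ E := by
    rintro E hE x hx y ⟨F, hF, hy⟩ hyx
    rcases hB.total hE hF with hle | hle
    exacts [mem_of_le_of_le hle hy hx hyx, mem_of_le hle hy]
  have hU : IsClosedUnbdd U := by
    refine ⟨fun γ hγ => ?_, fun b => ?_⟩
    · obtain ⟨E, hE, x, hx, hγx⟩ := hbig γ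
      exact ⟨E, hE, E.2.closed γ (hγ.mono fun y hy hyU => hUmem E hE x hx y hyU (hy.trans hγx).le)⟩
    · obtain ⟨E, hE, x, hx, hbx⟩ := hbig b
      exact ⟨x, ⟨E, hE, hx⟩, hbx⟩
  obtain ⟨δ, hδ, hlim, hguess⟩ := hg.guess U hU
  obtain ⟨E, hE, x, hx, hδx⟩ := hbig δ
  have hlt : ∀ y ∈ U, y < δ → y ∈ E := fun y hy hyδ => hUmem E hE x hx y hy (hyδ.trans hδx).le
  obtain ⟨b, hb, hb'⟩ := E.2.avoid δ hδ (hlim.mono fun y hy hyU => hlt y hyU hy)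
  obtain ⟨y, hy, hby⟩ := hguess b hb
  have hyδ := hg.lt δ hδ y hy.2
  exact absurd (hb' y (hlt y hy.1 hyδ) hy.2 hyδ) (not_le.2 hby)

theorem mk_le_of_isChain [LinearOrder K] {c : X → Set X} (h : RegularPair X K)
    (hg : ClubGuess X K a c) {B : Set (Node K a)} (hB : IsChain (· ≤ ·) B) : #B ≤ #K := by
  obtain ⟨b, hb⟩ := exists_height_le_of_isChain h hg hB
  refine (mk_le_of_injective (f := fun E : B => (⟨E.1.height, hb _ E.2⟩ : Iic b))
    fun E F hEF => ?_).trans (h.card_Iic b)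
  have heq : E.1.height = F.1.height := congrArg Subtype.val hEF
  refine Subtype.ext ?_
  rcases hB.total E.2 F.2 with hle | hle
  · exact hle.eq_of_not_lt fun hlt => (height_strictMono hlt).ne heq
  · exact (hle.eq_of_not_lt fun hlt => (height_strictMono hlt).ne heq.symm).symm

end Node

theorem HasOrderType.of_isChain {T : Type u} [PartialOrder T] [WellFoundedLT T] {B : Set T}
    (hB : IsChain (· ≤ ·) B) : ∃ o : Ordinal.{u}, o.card = #B ∧ HasOrderType B o := by
  have : IsWellOrder B (· < ·) :=
    { wf := wellFounded_lt
      trichotomous := fun x y hxy hyx => by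
        rcases hB.total x.2 y.2 with hle | hle
        · exact Subtype.ext (hle.eq_of_not_lt hxy)
        · exact Subtype.ext (hle.eq_of_not_lt hyx).symm }
  let e := Ordinal.enum (α := B) (· < ·)
  refine ⟨Ordinal.type (α := B) (· < ·), Ordinal.card_type _, ⟨?_⟩⟩
  exact (OrderIso.ofRelIsoLT e).symm

theorem Node.isCardTree [LinearOrder K] [WellFoundedLT X] {c : X → Set X}
    (h : RegularPair X K) (hg : ClubGuess X K a c) (hX : #X = Order.succ #K) :
    IsCardTree (Node K a) (Order.succ (Order.succ #K)) (Order.succ #K) where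
  isTree := Node.isTree
  branch_lt B hB := by
    obtain ⟨o, ho, hBo⟩ := HasOrderType.of_isChain hB.isChain
    refine ⟨o, ?_, hBo⟩
    rw [Cardinal.lt_ord, ho]
    exact Order.lt_succ_of_le (Node.mk_le_of_isChain h hg hB.isChain)
  succ_lt E := Order.lt_succ_of_le (hX ▸ E.mk_covBy_le)

end Nodes

/-! ### Limits of chains, transfinite runs and disjoint extensions -/

section Nodes

variable {X K : Type u} [LinearOrder X] {a : X → Set X}

/-- `U` together with its limit points. -/
def limClosure (U : Set X) : Set X := {x | x ∈ U ∨ IsLim U x}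

theorem IsLim.of_limClosure {U : Set X} {γ : X} (h : IsLim (limClosure U) γ) : IsLim U γ :=
  ⟨h.1, fun b hb => by
    obtain ⟨c, hc | hc, h1, h2⟩ := h.2 b hb
    · exact ⟨c, hc, h1, h2⟩
    · obtain ⟨d, hd, h3, h4⟩ := hc.2 b h1
      exact ⟨d, hd, h3, h4.trans h2⟩⟩

namespace Node

section Union

variable {ι : Type u} {D : ι → Node K a}

theorem mem_of_total (hD : ∀ i j, D i ≤ D j ∨ D j ≤ D i) {i j : ι} {x y : X} (hx : x ∈ D j)
    (hy : y ∈ D i) (hxy : x ≤ y) : x ∈ D i := by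
  rcases hD i j with hle | hle
  exacts [mem_of_le_of_le hle hx hy hxy, mem_of_le hle hx]

theorem mem_of_isLim_union (hD : ∀ i j, D i ≤ D j ∨ D j ≤ D i) {i : ι} {γ y : X}
    (hγ : IsLim {x | ∃ i, x ∈ D i} γ) (hy : y ∈ D i) (hγy : γ ≤ y) : γ ∈ D i ∧ IsLim (D i).1 γ := by
  have : IsLim (D i).1 γ := hγ.mono fun x hx ⟨j, hj⟩ => mem_of_total hD hj hy (hx.le.trans hγy)
  exact ⟨(D i).2.closed γ this, this⟩

/-- The closure of the union of a bounded chain of nodes is a node, if its last element is no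
obstacle. -/
theorem isNode_limClosure (hD : ∀ i j, D i ≤ D j ∨ D j ≤ D i)
    (hb : ∃ b, ∀ x ∈ limClosure {x | ∃ i, x ∈ D i}, x < b)
    (hlim : ∀ γ ∈ largeCof X K, IsLim {x | ∃ i, x ∈ D i} γ → (¬ ∃ i, γ ∈ D i) →
      ∃ b < γ, ∀ i, ∀ y ∈ D i, y ∈ a γ → y < γ → y ≤ b) :
    IsNode K a (limClosure {x | ∃ i, x ∈ D i}) := by
  refine ⟨fun γ hγ => Or.inr hγ.of_limClosure, hb, fun δ hδ hl => ?_⟩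
  have hU := hl.of_limClosure
  by_cases hmem : ∃ i, δ ∈ D i
  · obtain ⟨i, hi⟩ := hmem
    obtain ⟨b, hb, hb'⟩ := (D i).2.avoid δ hδ (mem_of_isLim_union hD hU hi le_rfl).2
    refine ⟨b, hb, fun y hy hya hyδ => hb' y ?_ hya hyδ⟩
    rcases hy with ⟨j, hj⟩ | hy
    exacts [mem_of_total hD hj hi hyδ.le, (mem_of_isLim_union hD hy hi hyδ.le).1]
  · obtain ⟨b, hb, hb'⟩ := hlim δ hδ hU hmem
    refine ⟨b, hb, fun y hy hya hyδ => ?_⟩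
    rcases hy with ⟨j, hj⟩ | hy
    · exact hb' j y hj hya hyδ
    · obtain ⟨c, ⟨i, hi⟩, hc, -⟩ := hU.2 y hyδ
      exact hb' i y (mem_of_isLim_union hD hy hi hc.le).1 hya hyδ

theorem le_limClosure [WellFoundedLT X] (hD : ∀ i j, D i ≤ D j ∨ D j ≤ D i)
    (hn : IsNode K a (limClosure {x | ∃ i, x ∈ D i})) (i : ι) : D i ≤ Node.mk _ hn := by
  refine le_iff.2 fun x => ⟨fun hx => ⟨Or.inl ⟨i, hx⟩, lt_height hx⟩, fun ⟨hx, hxi⟩ => ?_⟩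
  obtain ⟨y, hy, hxy⟩ := exists_of_lt_height hxi
  rcases hx with ⟨j, hj⟩ | hx
  exacts [mem_of_total hD hj hy hxy, (mem_of_isLim_union hD hx hy hxy).1]

/-- Each `D i` is closed and omits γ, hence is bounded below γ. Fewer than κ such bounds are cofinal
in γ, so limits of short chains meet no obstacle. -/
theorem notMem_largeCof (hι : #ι < #K) {γ : X} (hγ : IsLim {x | ∃ i, x ∈ D i} γ)
    (hmem : ¬ ∃ i, γ ∈ D i) : γ ∉ largeCof X K := by
  intro hcof
  have : ∀ i, ∃ b < γ, ∀ x ∈ D i, b < x → γ ≤ x := by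
    intro i
    by_contra hcon
    push Not at hcon
    exact hmem ⟨i, (D i).2.closed γ ⟨hγ.1, hcon⟩⟩
  choose b hb hb' using this
  obtain ⟨d, hd, hd'⟩ := hcof (range b) (by rintro _ ⟨i, rfl⟩; exact hb i) (mk_range_le.trans_lt hι)
  obtain ⟨c, ⟨i, hi⟩, h1, h2⟩ := hγ.2 d hd
  exact absurd (hb' i c hi ((hd' _ ⟨i, rfl⟩).trans h1)) (not_le.2 h2)

theorem exists_bound_limClosure [WellFoundedLT X] [LinearOrder K] (h : RegularPair X K)
    (hι : #ι ≤ #K) : ∃ b, ∀ x ∈ limClosure {x | ∃ i, x ∈ D i}, x < b := by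
  obtain ⟨b, hb⟩ := h.bdd_range hι fun i => (D i).height
  obtain ⟨d, hd⟩ := h.exists_gt b
  refine ⟨d, fun x hx => ?_⟩
  rcases hx with ⟨i, hi⟩ | hx
  · exact (lt_height hi).trans ((hb i).trans hd)
  · refine lt_of_le_of_lt (not_lt.1 fun hbx => ?_) hd
    obtain ⟨c, ⟨i, hi⟩, hc, -⟩ := hx.2 b hbx
    exact absurd ((lt_height hi).trans (hb i)) hc.not_gt

end Union

section Run

variable [LinearOrder K] [WellFoundedLT K]

open scoped Classical in
/-- The result of applying `Θ 0`, `Θ 1`, …, in turn, to `p₀`, taking closures of unions at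
limits. -/
noncomputable def run (p₀ : Node K a) (Θ : K → Node K a → Node K a) : K → Node K a :=
  (wellFounded_lt (α := K)).fix fun j f =>
    if hn : IsNode K a (limClosure {x | ∃ i : Option (Iio j),
        x ∈ i.elim p₀ fun i => Θ i (f i i.2)}) then Node.mk _ hn else p₀

/-- The nodes reached before step `j`. -/
noncomputable def stage (p₀ : Node K a) (Θ : K → Node K a → Node K a) (J : Set K) (i : Option J) :
    Node K a := i.elim p₀ fun i => Θ i (run p₀ Θ i)

variable {p₀ : Node K a} {Θ : K → Node K a → Node K a}

open scoped Classical in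
theorem run_eq (j : K) : run p₀ Θ j =
    if hn : IsNode K a (limClosure {x | ∃ i, x ∈ stage p₀ Θ (Iio j) i}) then Node.mk _ hn else p₀ :=
  WellFounded.fix_eq _ _ _

/-- Only the moves actually made matter, so an adaptive strategy can be replaced by the record of
its moves. -/
theorem run_congr {Θ' : K → Node K a → Node K a} (j : K)
    (hΘ : ∀ i < j, Θ i (run p₀ Θ i) = Θ' i (run p₀ Θ i)) : run p₀ Θ j = run p₀ Θ' j := by
  induction j using WellFoundedLT.induction with
  | ind j ih =>
    have hst : stage p₀ Θ (Iio j) = stage p₀ Θ' (Iio j) := by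
      funext i
      rcases i with _ | ⟨i, hi⟩
      · rfl
      · change Θ i (run p₀ Θ i) = Θ' i (run p₀ Θ' i)
        rw [← ih i hi fun l hl => hΘ l (lt_trans hl hi), hΘ i hi]
    rw [run_eq, run_eq, hst]

theorem stage_total {J : Set K} (hΘ : ∀ j p, p ≤ Θ j p)
    (h₁ : ∀ j ∈ J, ∀ i, stage p₀ Θ (Iio j) i ≤ run p₀ Θ j) (i j : Option J) :
    stage p₀ Θ J i ≤ stage p₀ Θ J j ∨ stage p₀ Θ J j ≤ stage p₀ Θ J i := by
  rcases i with _ | ⟨i, hi⟩ <;> rcases j with _ | ⟨j, hj⟩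
  · exact Or.inl le_rfl
  · exact Or.inl ((h₁ j hj none).trans (hΘ _ _))
  · exact Or.inr ((h₁ i hi none).trans (hΘ _ _))
  · rcases lt_trichotomy i j with hij | rfl | hij
    · exact Or.inl ((h₁ j hj (some ⟨i, hij⟩)).trans (hΘ _ _))
    · exact Or.inl le_rfl
    · exact Or.inr ((h₁ i hi (some ⟨j, hij⟩)).trans (hΘ _ _))

/-- Before step `j` fewer than κ nodes have been reached, so the closure of their union is a node
and the default value `p₀` in `run` never occurs. -/
theorem run_spec [WellFoundedLT X] (h : RegularPair X K) (hΘ : ∀ j p, p ≤ Θ j p) (j : K) :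
    (∀ x, x ∈ run p₀ Θ j ↔ x ∈ limClosure {x | ∃ i, x ∈ stage p₀ Θ (Iio j) i}) ∧
      ∀ i, stage p₀ Θ (Iio j) i ≤ run p₀ Θ j := by
  induction j using WellFoundedLT.induction with
  | ind j ih =>
    have htot := stage_total (p₀ := p₀) (J := Iio j) hΘ fun j hj => (ih j hj).2
    have hcard : #(Option (Iio j)) < #K := by
      rw [mk_option]
      exact add_lt_of_lt h.uncountable.le (h.card_Iio_index j)
        (one_lt_aleph0.trans h.uncountable)
    have hn := isNode_limClosure htot (exists_bound_limClosure h hcard.le)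
      fun γ hγ hl hmem => absurd hγ (notMem_largeCof hcard hl hmem)
    rw [(run_eq j).trans (dif_pos hn)]
    exact ⟨fun x => Iff.rfl, le_limClosure htot hn⟩

end Run

section Spread

variable [WellFoundedLT X] [LinearOrder K] [WellFoundedLT K]

/-- `Ψ p ν k`, for `k : K`, are extensions of `p` by pairwise disjoint sets of elements above `ν`,
each of them of the form `Φ p'` for some `p'` reaching beyond `ν`. -/
structure IsSpread (Φ : Node K a → Node K a) (Ψ : Node K a → X → K → Node K a) : Prop where
  le : ∀ p ν k, p ≤ Ψ p ν k
  exists_gt : ∀ p ν k, ∃ x ∈ Ψ p ν k, ν < x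
  mem_or_gt : ∀ p ν k, ∀ x ∈ Ψ p ν k, x ∈ p ∨ ν < x
  exists_eq : ∀ p ν k, ∃ p', p ≤ p' ∧ ν < p'.height ∧ Ψ p ν k = Φ p'
  disjoint : ∀ p ν k l, k ≠ l → ∀ x ∈ Ψ p ν k, x ∈ Ψ p ν l → x ∈ p

/-- Append to `p` a point `γ k` above ν and above everything added for earlier indices, then apply
Φ. -/
theorem exists_isSpread (h : RegularPair X K) {Φ : Node K a → Node K a} (hΦ : ∀ p, p ≤ Φ p) :
    ∃ Ψ, IsSpread Φ Ψ := by
  have key : ∀ (p : Node K a) (ν : X), ∃ f : K → Node K a, ∃ γ : K → X,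
      (∀ k, ν < γ k ∧ p ≤ f k ∧ γ k ∈ f k ∧ ∀ x ∈ Φ (f k), x < γ k → x ∈ p) ∧
      ∀ k, ∀ l < k, (Φ (f l)).height < γ k := by
    intro p ν
    classical
    let q : X → Node K a := fun γ => if hγ : p.height ≤ γ then p.snoc γ hγ (h.exists_gt γ) else p
    obtain ⟨γ, hγ⟩ := h.exists_sequence (fun x => (Φ (q x)).height) (max ν p.height)
    have hq : ∀ k, q (γ k) = p.snoc (γ k) ((le_max_right _ _).trans (hγ k).1.le) (h.exists_gt _) :=
      fun k => dif_pos _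
    refine ⟨fun k => q (γ k), γ, fun k => ⟨(le_max_left _ _).trans_lt (hγ k).1, ?_, ?_, ?_⟩,
      fun k l hlk => ((hγ k).2 l hlk).2⟩
    · change p ≤ q (γ k)
      rw [hq]
      exact (lt_snoc _ _ _ _).le
    · change γ k ∈ q (γ k)
      rw [hq]
      exact Or.inl rfl
    · intro x hx hxγ
      have hmem : γ k ∈ q (γ k) := by
        rw [hq]
        exact Or.inl rfl
      have : x ∈ q (γ k) := mem_of_le_of_le (hΦ _) hx hmem hxγ.le
      rw [hq] at this
      exact this.resolve_left hxγ.ne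
  choose f γ hf hγ using key
  have hdisj : ∀ p ν k l, l < k → ∀ x ∈ Φ (f p ν k), x ∈ Φ (f p ν l) → x ∈ p :=
    fun p ν k l hlk x hx hxl => (hf p ν k).2.2.2 x hx ((lt_height hxl).trans (hγ p ν k l hlk))
  refine ⟨fun p ν k => Φ (f p ν k), ⟨fun p ν k => ((hf p ν k).2.1).trans (hΦ _),
    fun p ν k => ⟨γ p ν k, mem_of_le (hΦ _) (hf p ν k).2.2.1, (hf p ν k).1⟩, fun p ν k x hx => ?_,
    fun p ν k => ⟨f p ν k, (hf p ν k).2.1, (hf p ν k).1.trans (lt_height (hf p ν k).2.2.1), rfl⟩,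
    fun p ν k l hkl x hx hxl => ?_⟩⟩
  · refine (lt_or_ge x (γ p ν k)).imp ((hf p ν k).2.2.2 x hx) fun hle => (hf p ν k).1.trans_le hle
  · rcases lt_or_gt_of_ne hkl with hlt | hlt
    exacts [hdisj p ν l k hlt x hxl hx, hdisj p ν k l hlt x hx hxl]

/-- The moves in a run may be recorded by a sequence. -/
def move (Ψ : Node K a → X → K → Node K a) (s : K → X × K) (j : K) (p : Node K a) : Node K a :=
  Ψ p (s j).1 (s j).2

/-- Up to step `j`, a run with parameters below ν is determined by a function from `Iio j` to a set
of size at most κ. By κ^{<κ} = κ there are at most κ such runs, so their heights are bounded in κ⁺.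
-/
theorem exists_growth (h : RegularPair X K) (p₀ : Node K a) (Ψ : Node K a → X → K → Node K a) :
    ∃ m : X → X, (∀ x, x < m x) ∧ ∀ ν j (s : K → X × K), (∀ i < j, (s i).1 < ν) →
      ∀ ν' < ν, ∀ k, (Ψ (run p₀ (move Ψ s) j) ν' k).height < m ν := by
  have key : ∀ ν : X, ∃ b, ν < b ∧ ∀ j (s : K → X × K), (∀ i < j, (s i).1 < ν) →
      ∀ ν' < ν, ∀ k, (Ψ (run p₀ (move Ψ s) j) ν' k).height < b := by
    intro ν
    classical
    -- The value from `t.1` onwards is arbitrary.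
    let s' : (Σ j : K, Iio j → Iio ν × K) → K → X × K := fun t i =>
      if hi : i < t.1 then ((t.2 ⟨i, hi⟩).1, (t.2 ⟨i, hi⟩).2) else (ν, i)
    have hc : #(Iio ν × K) ≤ #K := by
      rw [mk_prod, lift_id, lift_id]
      exact (mul_le_mul_left (h.card_Iio ν) _).trans (mul_eq_self h.uncountable.le).le
    have hcard : #((Σ j : K, Iio j → Iio ν × K) × (Iio ν × K)) ≤ #K := by
      rw [mk_prod, lift_id, lift_id, mk_sigma]
      refine (mul_le_mul' ?_ hc).trans (mul_eq_self h.uncountable.le).le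
      refine (sum_le_sum _ (fun _ => #K) fun j => ?_).trans ?_
      · rw [← power_def]
        exact (power_le_power_right hc).trans (h.power j)
      · rw [sum_const']
        exact (mul_eq_self h.uncountable.le).le
    obtain ⟨b, hb⟩ := h.bdd_range hcard fun t =>
      (Ψ (run p₀ (move Ψ (s' t.1)) t.1.1) t.2.1 t.2.2).height
    obtain ⟨d, hd⟩ := h.exists_gt ν
    refine ⟨max b d, lt_max_of_lt_right hd, fun j s hs ν' hν' k => lt_max_of_lt_left ?_⟩
    let t : Iio j → Iio ν × K := fun i => (⟨(s i).1, hs i i.2⟩, (s i).2)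
    have hrun : run p₀ (move Ψ s) j = run p₀ (move Ψ (s' ⟨j, t⟩)) j := by
      refine run_congr j fun i hi => ?_
      have : s' ⟨j, t⟩ i = s i := dif_pos hi
      rw [move, move, this]
    rw [hrun]
    exact hb (⟨j, t⟩, (⟨ν', hν'⟩, k))
  choose m hm using key
  exact ⟨m, fun x => (hm x).1, fun ν => (hm ν).2⟩

end Spread

end Node
end Nodes

/-! ### Closed nodes and distributivity -/

section Nodes

variable {X K : Type u} [LinearOrder X] [LinearOrder K] [WellFoundedLT X] [WellFoundedLT K]
  {a c : X → Set X}

namespace Node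

section Limit

variable {p₀ : Node K a} {Φ : Node K a → Node K a} {Ψ : Node K a → X → K → Node K a}

/-- In a run that avoids `a δ` and in which each move jumps over a point of `c δ`, no element of
`a δ` occurs. -/
theorem mem_of_mem_stage (h : RegularPair X K) (hg : ClubGuess X K a c) (hΨ : IsSpread Φ Ψ) {δ : X}
    (hδ : δ ∈ largeCof X K) (Θ : K → Node K a → Node K a) (ν : K → X) (k : K → K)
    (hΘle : ∀ j p, p ≤ Θ j p)
    (hΘ : ∀ j, Θ j (run p₀ Θ j) = Ψ (run p₀ Θ j) (ν j) (k j)) {J : Set K}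
    (hJ : ∀ j ∈ J, ∀ i < j, i ∈ J)
    (hc : ∀ j ∈ J, ∃ y ∈ c δ, (run p₀ Θ j).height ≤ y ∧ y ≤ ν j)
    (ha : ∀ j ∈ J, ∀ x ∈ Θ j (run p₀ Θ j), x ∈ a δ → x ∈ run p₀ Θ j) :
    ∀ j ∈ J, ∀ x ∈ Θ j (run p₀ Θ j), x ∈ a δ → x ∈ p₀ := by
  intro j
  have hspec := run_spec (p₀ := p₀) (Θ := Θ) h hΘle
  induction j using WellFoundedLT.induction with
  | ind j ih =>
    intro hj x hx hxa
    have hxr := ha j hj x hx hxa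
    rcases ((hspec j).1 x).1 hxr with ⟨i, hi⟩ | hlim
    · rcases i with _ | ⟨i, hij⟩
      exacts [hi, ih i hij (hJ j hj i hij) x hi hxa]
    by_cases hmem : ∃ i, x ∈ stage p₀ Θ (Iio j) i
    · obtain ⟨i, hi⟩ := hmem
      rcases i with _ | ⟨i, hij⟩
      exacts [hi, ih i hij (hJ j hj i hij) x hi hxa]
    -- Here `x` is a new limit point. It is shown to be a limit of `c δ`, which `a δ` excludes.
    refine absurd ⟨hlim.1, fun b hb => ?_⟩ (hg.not_isLim δ hδ x hxa)
    obtain ⟨u, ⟨w, hu⟩, hbu, hux⟩ := hlim.2 b hb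
    have htot := stage_total (p₀ := p₀) (Θ := Θ) (J := Iio j) hΘle fun i _ => (hspec i).2
    set W := stage p₀ Θ (Iio j) w with hW
    have hnew : ∀ (l : K) (y : X), IsLim {x | ∃ i, x ∈ stage p₀ Θ (Iio l) i} y → y ∉ W →
        ∃ i, ∃ z ∈ stage p₀ Θ (Iio l) i, z < y ∧ z ∉ W := by
      intro l y hy hyW
      by_contra hcon
      push Not at hcon
      exact hyW (W.2.closed y (hy.mono fun z hz ⟨i, hi⟩ => hcon i z hi hz))
    have hp₀ : p₀ ≤ W := by
      rcases w with _ | ⟨i, hi⟩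
      exacts [le_rfl, ((hspec i).2 none).trans (hΘle _ _)]
    -- The first move after `W` that adds a point below `x`. It jumps over a point of `c δ`, which
    -- therefore lies between `u` and `x`.
    obtain ⟨l, ⟨hlj, y, hy, hyx, hyW⟩, hmin⟩ := WellFounded.has_min (wellFounded_lt (α := K))
      {l | l < j ∧ ∃ y ∈ Θ l (run p₀ Θ l), y < x ∧ y ∉ W} (by
        obtain ⟨i, z, hz, hzx, hzW⟩ := hnew j x hlim fun hxW => hmem ⟨w, hxW⟩
        rcases i with _ | ⟨i, hi⟩
        · exact absurd (mem_of_le hp₀ hz) hzW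
        · exact ⟨i, hi, z, hz, hzx, hzW⟩)
    have hWl : W ≤ run p₀ Θ l := by
      rcases w with _ | ⟨i, hi⟩
      · exact (hspec l).2 none
      · rcases lt_or_ge i l with hil | hli
        · exact (hspec l).2 (some ⟨i, hil⟩)
        · refine absurd (mem_of_le ?_ hy) hyW
          rcases hli.eq_or_lt with rfl | hli
          · exact le_rfl
          · exact ((hspec i).2 (some ⟨l, hli⟩)).trans (hΘle _ _)
    have hyl : y ∉ run p₀ Θ l := by
      intro hyl
      have hold : ∀ i, ∀ z ∈ stage p₀ Θ (Iio l) i, z ≤ y → z ∈ W := by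
        intro i z hz hzy
        by_contra hzW
        rcases i with _ | ⟨i, hi⟩
        · exact hzW (mem_of_le hp₀ hz)
        · exact hmin i ⟨lt_trans hi hlj, z, hz, hzy.trans_lt hyx, hzW⟩ hi
      rcases ((hspec l).1 y).1 hyl with ⟨i, hi⟩ | hy'
      · exact hyW (hold i y hi le_rfl)
      · obtain ⟨i, z, hz, hzy, hzW⟩ := hnew l y hy' hyW
        exact hzW (hold i z hz hzy.le)
    obtain ⟨z, hz, hz1, hz2⟩ := hc l (hJ j hj l hlj)
    rw [hΘ l] at hy
    refine ⟨z, hz, ?_, ?_⟩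
    · exact hbu.trans ((lt_height (mem_of_le hWl hu)).trans_le hz1)
    · exact hz2.trans_lt (((hΨ.mem_or_gt _ _ _ y hy).resolve_left hyl).trans hyx)

end Limit

/-- Each extension function on the tree and each stationary set admit a node which is closed, at
some point of the stationary set, under the function. -/
theorem exists_closed_node (h : RegularPair X K) (hg : ClubGuess X K a c) {Φ : Node K a → Node K a}
    (hΦ : ∀ p, p ≤ Φ p) (p₀ : Node K a) {S : Set X} (hS : MeetsClosurePoints S) :
    ∃ δ ∈ S, (∃ b, b < δ) ∧ ∃ q, p₀ ≤ q ∧ ∀ b < δ, ∃ p, p₀ ≤ p ∧ p ≤ q ∧ b < p.height ∧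
      (Φ p).height < δ ∧ Φ p ≤ q := by
  obtain ⟨Ψ, hΨ⟩ := exists_isSpread h hΦ
  obtain ⟨m, hlt, hm⟩ := exists_growth h p₀ Ψ
  obtain ⟨δ, hδS, hne, hcl⟩ := hS m
  obtain ⟨f, hf⟩ := h.exists_surjection hne
  refine ⟨δ, hδS, hne, ?_⟩
  -- The parameter passes `f j`, which makes the run cofinal in δ, and for δ of cofinality κ also a
  -- point of `c δ` beyond the current height.
  have hν : ∀ (j : K) (p : Node K a), ∃ ν : X, (δ ∉ largeCof X K → ν = f j) ∧ f j ≤ ν ∧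
      (δ ∈ largeCof X K → p.height < δ → ν < δ ∧ ∃ y ∈ c δ, p.height ≤ y ∧ y ≤ ν) := by
    intro j p
    by_cases hδ : δ ∈ largeCof X K ∧ p.height < δ
    · obtain ⟨y, hy, hpy, hyδ⟩ := hg.unbdd δ hδ.1 _ hδ.2
      exact ⟨max (f j) y, fun h => absurd hδ.1 h, le_max_left _ _,
        fun _ _ => ⟨max_lt (f j).2 hyδ, y, hy, hpy, le_max_right _ _⟩⟩
    · exact ⟨f j, fun _ => rfl, le_rfl, fun h1 h2 => absurd ⟨h1, h2⟩ hδ⟩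
  choose ν hν₁ hν₂ hν₃ using hν
  have hk : ∀ (j : K) (p : Node K a), ∃ k, (∃ k', ∀ x ∈ Ψ p (ν j p) k', x ∈ a δ → x ∈ p) →
      ∀ x ∈ Ψ p (ν j p) k, x ∈ a δ → x ∈ p := by
    intro j p
    by_cases hex : ∃ k', ∀ x ∈ Ψ p (ν j p) k', x ∈ a δ → x ∈ p
    · exact ⟨hex.choose, fun _ => hex.choose_spec⟩
    · exact ⟨j, fun h => absurd h hex⟩
  choose k hk using hk
  let Θ : K → Node K a → Node K a := fun j p => Ψ p (ν j p) (k j p)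
  have hΘle : ∀ j p, p ≤ Θ j p := fun j p => hΨ.le _ _ _
  let r : K → Node K a := run p₀ Θ
  let s : K → X × K := fun j => (ν j (r j), k j (r j))
  have hrs : ∀ j, r j = run p₀ (move Ψ s) j := fun j => run_congr j fun i _ => rfl
  have hspec := run_spec (p₀ := p₀) (Θ := Θ) h hΘle
  -- The run is cut at the first index where the values of `f` become unbounded in δ, if there is
  -- one; this keeps all earlier stages below δ.
  let J : Set K := {j | ∃ b < δ, ∀ i < j, f i < b}
  have hJ : ∀ j ∈ J, ∀ i < j, i ∈ J := fun j ⟨b, hb, hb'⟩ i hij =>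
    ⟨b, hb, fun l hl => hb' l (hl.trans hij)⟩
  have hJf : ∀ b < δ, ∃ j ∈ J, b ≤ f j := by
    intro b hb
    by_cases hall : ∀ j, j ∈ J
    · obtain ⟨j, hj⟩ := hf ⟨b, hb⟩
      exact ⟨j, hall j, by rw [hj]⟩
    · push Not at hall
      obtain ⟨j, hj, hmin⟩ := WellFounded.has_min (wellFounded_lt (α := K)) {j | j ∉ J} hall
      by_contra hcon
      push Not at hcon
      exact hj ⟨b, hb, fun i hij => hcon i (not_not.1 fun hi => hmin i hi hij)⟩
  -- bounds for the nodes and moves of the run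
  have hbound : ∀ j ∈ J, (∀ i < j, ν i (r i) < δ) → ∃ b < δ, ∀ i < j, ν i (r i) < b := by
    rintro j ⟨b, hb, hb'⟩ hi
    by_cases hδ : δ ∈ largeCof X K
    · obtain ⟨d, hd, hd'⟩ := hδ (range fun i : Iio j => ν i (r i))
        (by rintro _ ⟨i, rfl⟩; exact hi i i.2) (mk_range_le.trans_lt (h.card_Iio_index j))
      exact ⟨d, hd, fun i hij => hd' _ ⟨⟨i, hij⟩, rfl⟩⟩
    · exact ⟨b, hb, fun i hij => by rw [hν₁ i (r i) hδ]; exact hb' i hij⟩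
  have hstep : ∀ j ∈ J, (∀ i < j, ν i (r i) < δ) → ∀ x < δ, ∃ t < δ, ∀ l,
      (Ψ (r j) x l).height < t := by
    intro j hj hi x hx
    obtain ⟨b, hb, hb'⟩ := hbound j hj hi
    have hmx := hcl _ (max_lt hb hx)
    -- The inner `m` turns bounds by `max b x` into the strict inequalities that `hm` requires.
    refine ⟨m (m (max b x)), hcl _ hmx, fun l => ?_⟩
    rw [hrs]
    exact hm _ j s (fun i hij => (hb' i hij).trans ((le_max_left b x).trans_lt (hlt _))) x
      ((le_max_right b x).trans_lt (hlt _)) l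
  have hrun : ∀ j ∈ J, (r j).height < δ ∧ ν j (r j) < δ := by
    intro j
    induction j using WellFoundedLT.induction with
    | ind j ih =>
      intro hj
      obtain ⟨t, ht, ht'⟩ := hstep j hj (fun i hij => (ih i hij (hJ j hj i hij)).2) _ (f j).2
      have h1 : (r j).height < δ := (height_mono (hΨ.le _ _ _)).trans_lt ((ht' j).trans ht)
      refine ⟨h1, ?_⟩
      by_cases hδ : δ ∈ largeCof X K
      · exact (hν₃ j (r j) hδ h1).1
      · rw [hν₁ j (r j) hδ]
        exact (f j).2
  have hΘlt : ∀ j ∈ J, ∃ t < δ, ∀ l, (Ψ (r j) (ν j (r j)) l).height < t := fun j hj =>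
    hstep j hj (fun i hij => (hrun i (hJ j hj i hij)).2) _ (hrun j hj).2
  have hΘδ : ∀ j ∈ J, (Θ j (r j)).height < δ := fun j hj => by
    obtain ⟨t, ht, ht'⟩ := hΘlt j hj
    exact (ht' _).trans ht
  have havoid : δ ∈ largeCof X K → ∀ j ∈ J, ∀ x ∈ Θ j (r j), x ∈ a δ → x ∈ r j := by
    intro hδ j hj
    refine hk j (r j) ?_
    by_contra hcon
    push Not at hcon
    choose x hx hxa hxr using hcon
    obtain ⟨t, ht, ht'⟩ := hΘlt j hj
    -- Were every version to add a point of `a δ`, disjointness would give κ points of `a δ` below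
    -- `t`.
    refine (hg.card_lt δ hδ t ht).not_ge (mk_le_of_injective
      (f := fun l => (⟨x l, hxa l, (lt_height (hx l)).trans (ht' l)⟩ : (a δ ∩ Iio t : Set X))) ?_)
    intro l l' hll
    have heq : x l = x l' := congrArg Subtype.val hll
    by_contra hne
    exact hxr l (hΨ.disjoint _ _ _ _ hne (x l) (hx l) (heq ▸ hx l'))
  have htot := stage_total (p₀ := p₀) (Θ := Θ) (J := J) hΘle fun i _ => (hspec i).2
  have hUδ : ∀ i, ∀ x ∈ stage p₀ Θ J i, x < δ := by
    rintro (_ | ⟨i, hi⟩) x hx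
    · obtain ⟨b, hb⟩ := hne
      obtain ⟨j, hj, -⟩ := hJf b hb
      exact (lt_height (mem_of_le ((hspec j).2 none) hx)).trans (hrun j hj).1
    · exact (lt_height hx).trans (hΘδ i hi)
  have hcard : #(Option J) ≤ #K := by
    rw [mk_option]
    exact (add_le_add (mk_set_le J) (one_lt_aleph0.trans h.uncountable).le).trans
      (add_eq_self h.uncountable.le).le
  have hn := isNode_limClosure htot (exists_bound_limClosure h hcard) (by
    intro γ hγ hl hmem
    -- Below δ, limit points are absorbed by a later stage; above δ there are none.
    have hγδ : γ = δ := by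
      rcases lt_trichotomy γ δ with hlt | heq | hgt
      · obtain ⟨j, hj, hjf⟩ := hJf γ hlt
        obtain ⟨x, hx, hx'⟩ := hΨ.exists_gt (r j) (ν j (r j)) (k j (r j))
        exact absurd ⟨some ⟨j, hj⟩, (mem_of_isLim_union (D := stage p₀ Θ J) (i := some ⟨j, hj⟩) htot
          hl hx (hjf.trans ((hν₂ j (r j)).trans hx'.le))).1⟩ hmem
      · exact heq
      · obtain ⟨x, ⟨i, hi⟩, hx, -⟩ := hl.2 δ hgt
        exact absurd (hUδ i x hi) hx.not_gt
    subst hγδ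
    have hp₀ : p₀.height < γ := by
      obtain ⟨b, hb⟩ := hne
      obtain ⟨j, hj, -⟩ := hJf b hb
      exact (height_mono ((hspec j).2 none)).trans_lt (hrun j hj).1
    refine ⟨p₀.height, hp₀, fun i y hy hya _ => ?_⟩
    rcases i with _ | ⟨i, hi⟩
    · exact (lt_height hy).le
    · refine (lt_height (mem_of_mem_stage h hg hΨ hγ Θ (fun j => ν j (r j)) (fun j => k j (r j)) hΘle
        (fun j => rfl) hJ (fun j hj => (hν₃ j (r j) hγ (hrun j hj).1).2) (havoid hγ) i hi y hy
        hya)).le)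
  have hle := le_limClosure htot hn
  refine ⟨Node.mk _ hn, hle none, fun b hb => ?_⟩
  obtain ⟨j, hj, hjf⟩ := hJf b hb
  obtain ⟨p, hp, hνp, hpΦ⟩ := hΨ.exists_eq (r j) (ν j (r j)) (k j (r j))
  have hΦq : Φ p ≤ Node.mk _ hn := hpΦ ▸ hle (some ⟨j, hj⟩)
  exact ⟨p, ((hspec j).2 none).trans hp, (hΦ p).trans hΦq, (hjf.trans (hν₂ _ _)).trans_lt hνp,
    hpΦ ▸ hΘδ j hj, hΦq⟩

/-- The intersection of at most `#K` dense open sets is dense. -/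
theorem exists_mem_forall (h : RegularPair X K) (hg : ClubGuess X K a c) {D : K → Set (Node K a)}
    (hopen : ∀ k, ∀ p ∈ D k, ∀ q, p ≤ q → q ∈ D k) (hdense : ∀ k p, ∃ q ∈ D k, p ≤ q)
    (p₀ : Node K a) : ∃ q, p₀ ≤ q ∧ ∀ k, q ∈ D k := by
  -- Φ moves into the first dense set not yet entered.
  have key : ∀ p : Node K a, ∃ q, p ≤ q ∧ ∀ k, p ∉ D k → (∀ l < k, p ∈ D l) → q ∈ D k := by
    intro p
    by_cases hex : ∃ k, p ∉ D k ∧ ∀ l < k, p ∈ D l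
    · obtain ⟨k, hk, hk'⟩ := hex
      obtain ⟨q, hq, hpq⟩ := hdense k p
      refine ⟨q, hpq, fun l hl hl' => ?_⟩
      have : k = l := le_antisymm (not_lt.1 fun hlk => hl (hk' l hlk))
        (not_lt.1 fun hlk => hk (hl' k hlk))
      exact this ▸ hq
    · exact ⟨p, le_rfl, fun k h1 h2 => absurd ⟨k, h1, h2⟩ hex⟩
  choose Φ hΦ hΦD using key
  obtain ⟨δ, hδ, -, q, hq, hcl⟩ := exists_closed_node h hg hΦ p₀ h.largeCof_meetsClosurePoints
  refine ⟨q, hq, ?_⟩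
  by_contra hcon
  push Not at hcon
  obtain ⟨k, hk⟩ := hcon
  have hleast : ∀ p ≤ q, ∃ l ≤ k, p ∉ D l ∧ ∀ i < l, p ∈ D i := by
    intro p hp
    have hpk : p ∉ D k := fun hpD => hk (hopen k p hpD q hp)
    obtain ⟨l, hl, hmin⟩ := WellFounded.has_min (wellFounded_lt (α := K)) {l | p ∉ D l} ⟨k, hpk⟩
    exact ⟨l, not_lt.1 (hmin k hpk), hl, fun i hi => not_not.1 fun h => hmin i h hi⟩
  -- Once `Φ p` has entered `D l`, no higher node below `q` has `l` as its first missing index.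
  -- Fewer than κ indices up to `k` thus leave a bound below δ, beyond which `q` still contains a
  -- node closed under Φ.
  have hbd : ∀ l : Iic k, ∃ b < δ, ∀ p ≤ q, Φ p ≤ q → (Φ p).height < δ → p ∉ D l →
      (∀ i < l.1, p ∈ D i) → p.height ≤ b := by
    intro l
    by_cases hex : ∃ p ≤ q, Φ p ≤ q ∧ (Φ p).height < δ ∧ p ∉ D l ∧ ∀ i < l.1, p ∈ D i
    · obtain ⟨p, hp, hΦp, hlt, hpl, hpi⟩ := hex
      refine ⟨_, hlt, fun p' hp' _ _ hpl' _ => not_lt.1 fun hlt' => hpl' ?_⟩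
      exact hopen _ _ (hΦD p l hpl hpi) _ (le_of_height_le hΦp hp' hlt'.le)
    · obtain ⟨b, hb, -⟩ := hδ ∅ (empty_subset _) (by simpa using aleph0_pos.trans h.uncountable)
      exact ⟨b, hb, fun p h1 h2 h3 h4 h5 => absurd ⟨p, h1, h2, h3, h4, h5⟩ hex⟩
  choose b hb hb' using hbd
  obtain ⟨d, hd, hd'⟩ := hδ (range b) (by rintro _ ⟨l, rfl⟩; exact hb l)
    (mk_range_le.trans_lt (h.card_Iic_index k))
  obtain ⟨p, -, hpq, hdp, hΦδ, hΦq⟩ := hcl d hd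
  obtain ⟨l, hlk, hl, hl'⟩ := hleast p hpq
  exact absurd ((hb' ⟨l, hlk⟩ p hpq hΦq hΦδ hl hl').trans_lt (hd' _ ⟨_, rfl⟩)) hdp.not_gt

end Node
end Nodes

/-! ### Levels and the generic branch of a tree -/

section Rank

variable {T : Type u} [PartialOrder T] [WellFoundedLT T]

/-- The level of an element of a tree. -/
noncomputable def level (x : T) : Ordinal.{u} := IsWellFounded.rank (α := T) (· < ·) x

theorem level_strictMono : StrictMono (level (T := T)) :=
  fun _ _ h => IsWellFounded.rank_lt_of_rel h

theorem exists_level_eq (x : T) {β : Ordinal} (hβ : β < level x) : ∃ y < x, level y = β := by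
  induction x using WellFoundedLT.induction with
  | ind x ih =>
    rw [level, IsWellFounded.rank_eq, Ordinal.lt_iSup_iff] at hβ
    obtain ⟨⟨y, hy⟩, hβ⟩ := hβ
    rcases (Order.lt_succ_iff.1 hβ).eq_or_lt with heq | hlt
    · exact ⟨y, hy, heq.symm⟩
    · obtain ⟨z, hz, hz'⟩ := ih y hy hlt
      exact ⟨z, hz.trans hy, hz'⟩

theorem card_level_le (x : T) : (level x).card ≤ #(Iio x) := by
  have : ∀ β : Iio (level x), ∃ y : Iio x, level y.1 = β := fun β => by
    obtain ⟨y, hy, hβ⟩ := exists_level_eq x β.2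
    exact ⟨⟨y, hy⟩, hβ⟩
  choose f hf using this
  have hle := mk_le_of_injective (f := fun β : ULift.{u} (level x).ToType =>
    f (Ordinal.ToType.toOrd β.down)) fun β γ h => by
      have : (Ordinal.ToType.toOrd β.down) = Ordinal.ToType.toOrd γ.down :=
        Subtype.ext ((hf _).symm.trans ((congrArg (fun y : Iio x => level y.1) h).trans (hf _)))
      exact ULift.ext _ _ (Ordinal.ToType.mk.symm.injective this)
  simpa using hle

/-- The generic branch of a tree. -/
def genericBranch (T : Type u) : SetName Tᵒᵈ T := {y | y.2 = OrderDual.toDual y.1}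

/-- The increasing enumeration of the generic branch. -/
def genericEnum (T : Type u) [PartialOrder T] [WellFoundedLT T] (o : Ordinal.{u}) :
    SetName Tᵒᵈ (Iio o × T) :=
  {y | level y.1.2 = y.1.1 ∧ y.2 = OrderDual.toDual y.1.2}

omit [WellFoundedLT T] in
theorem mem_genericBranch {x : T} {p : Tᵒᵈ} : FStmt.mem x (genericBranch T) p ↔
    ∀ q ≤ p, ∃ r ≤ q, r ≤ OrderDual.toDual x :=
  ⟨fun h q hq => by
    obtain ⟨r, hr, s, hs, hs'⟩ := h q hq
    exact ⟨r, hr, hs.trans hs'.le⟩, fun h q hq => by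
    obtain ⟨r, hr, hs⟩ := h q hq
    exact ⟨r, hr, _, hs, rfl⟩⟩

theorem mem_genericEnum {o : Ordinal.{u}} {α : Iio o} {x : T} {p : Tᵒᵈ} :
    FStmt.mem (α, x) (genericEnum T o) p ↔
      level x = α ∧ FStmt.mem x (genericBranch T) p := by
  rw [mem_genericBranch]
  refine ⟨fun h => ⟨?_, fun q hq => ?_⟩, fun h q hq => ?_⟩
  · obtain ⟨r, hr, s, hs, hs'⟩ := h p le_rfl
    exact hs'.1
  · obtain ⟨r, hr, s, hs, hs'⟩ := h q hq
    exact ⟨r, hr, hs.trans hs'.2.le⟩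
  · obtain ⟨r, hr, hs⟩ := h.2 q hq
    exact ⟨r, hr, _, hs, h.1, rfl⟩

/-- Splitting makes the generic chain maximal, and density of high levels makes its enumeration by
level total on the whole of `kap.ord`. -/
theorem addsBranch_of_level (hT : IsTree T) {kap : Cardinal.{u}}
    (hsplit : ∀ x y : T, x < y → ∃ z, x ≤ z ∧ ¬ z ≤ y ∧ ¬ y ≤ z)
    (hlt : ∀ x : T, level x < kap.ord)
    (hlevel : ∀ α < kap.ord, ∀ x : T, ∃ y, x ≤ y ∧ α ≤ level y) : AddsBranch Tᵒᵈ T kap := by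
  have htot : ∀ {x y z : T}, x ≤ z → y ≤ z → x ≤ y ∨ y ≤ x := by
    intro x y z hx hy
    rcases hx.eq_or_lt with rfl | hx
    · exact Or.inr hy
    rcases hy.eq_or_lt with rfl | hy
    · exact Or.inl hx.le
    · exact (hT.isChain_Iio z).total hx hy
  have hcomp : ∀ {x y : T} {p : Tᵒᵈ}, FStmt.mem x (genericBranch T) p →
      FStmt.mem y (genericBranch T) p → x ≤ y ∨ y ≤ x := by
    intro x y p hx hy
    rw [mem_genericBranch] at hx hy
    obtain ⟨q, hq, hqx⟩ := hx p le_rfl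
    obtain ⟨r, hr, hry⟩ := hy q hq
    exact htot (z := OrderDual.ofDual r) (hr.trans hqx) hry
  have hmono : ∀ {x : T} {p q : Tᵒᵈ}, q ≤ p → FStmt.mem x (genericBranch T) p →
      FStmt.mem x (genericBranch T) q := fun hqp h r hr => h r (hr.trans hqp)
  have hself : ∀ {x : T} {p : Tᵒᵈ}, p ≤ OrderDual.toDual x → FStmt.mem x (genericBranch T) p :=
    fun hp => mem_genericBranch.2 fun q hq => ⟨q, le_rfl, hq.trans hp⟩
  intro p q _
  refine ⟨q, le_rfl, genericBranch T, ⟨⟨?_, ?_⟩, ?_⟩⟩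
  · exact fun x y q₁ _ hx q₂ hq₂ hy => hcomp (hmono hq₂ hx) hy
  · intro x q₁ _ hx
    rw [mem_genericBranch]
    intro q₂ hq₂
    rcases hx (OrderDual.ofDual q₂) q₂ hq₂ (hself le_rfl) with hle | hle
    · exact ⟨q₂, le_rfl, hle⟩
    rcases hle.eq_or_lt with heq | hlt
    · exact ⟨q₂, le_rfl, heq.symm.le⟩
    -- A condition strictly below `x` could be extended to `z`, which forces `z` into the branch
    -- although it is incomparable with `x`.
    obtain ⟨z, hz, hzx, hxz⟩ := hsplit _ _ hlt
    rcases hx z (OrderDual.toDual z) (le_trans (b := q₂) hz hq₂) (hself le_rfl) with h | h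
    exacts [absurd h hxz, absurd h hzx]
  · refine fun q₁ _ => ⟨q₁, le_rfl, genericEnum T kap.ord, ⟨⟨?_, ?_, ?_⟩, ?_⟩⟩
    · intro α q₂ _
      obtain ⟨y, hy, hαy⟩ := hlevel α α.2 (OrderDual.ofDual q₂)
      have : ∃ z ≤ y, level z = α := by
        rcases hαy.eq_or_lt with heq | hlt
        · exact ⟨y, le_rfl, heq.symm⟩
        · obtain ⟨z, hz, hz'⟩ := exists_level_eq y hlt
          exact ⟨z, hz.le, hz'⟩
      obtain ⟨z, hz, hz'⟩ := this
      exact ⟨OrderDual.toDual y, hy, z, mem_genericEnum.2 ⟨hz', hself hz⟩⟩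
    · intro α y y' q₂ _ hy q₃ hq₃ hy'
      rw [mem_genericEnum] at hy hy'
      have heq : level y = level y' := hy.1.trans hy'.1.symm
      rcases hcomp (hmono hq₃ hy.2) hy'.2 with hle | hle
      · exact hle.eq_of_not_lt fun h => (level_strictMono h).ne heq
      · exact (hle.eq_of_not_lt fun h => (level_strictMono h).ne heq.symm).symm
    · intro y
      refine ⟨fun q₂ _ hy q₃ hq₃ => ⟨q₃, le_rfl, ⟨level y, hlt y⟩, ?_⟩, fun q₂ _ hy q₃ hq₃ => ?_⟩
      · exact mem_genericEnum.2 ⟨rfl, hmono hq₃ hy⟩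
      · obtain ⟨r, hr, α, hα⟩ := hy q₃ hq₃
        obtain ⟨r', hr', s, hs, hs'⟩ := (mem_genericEnum.1 hα).2 r le_rfl
        exact ⟨r', hr'.trans hr, s, hs, hs'⟩
    · intro α β y y' q₂ _ hαβ q₃ hq₃ hy q₄ hq₄ hy'
      rw [mem_genericEnum] at hy hy'
      have hlev : level y < level y' := by
        rw [hy.1, hy'.1]
        exact hαβ
      rcases hcomp (hmono hq₄ hy.2) hy'.2 with hle | hle
      · exact lt_of_le_of_ne hle fun h => hlev.ne (congrArg _ h)
      · exact absurd hlev (level_strictMono.monotone hle).not_gt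

end Rank

/-! ### Verification of semi-properness -/

section Nodes

variable {X K : Type u} [LinearOrder X] [LinearOrder K] [WellFoundedLT X] [WellFoundedLT K]
  {a c : X → Set X}

namespace Node

theorem exists_mem_forall_of_lift_le (h : RegularPair X K) (hg : ClubGuess X K a c) {ι : Type v}
    (hι : lift.{u} #ι ≤ lift.{v} #K) {D : ι → Set (Node K a)}
    (hopen : ∀ i, ∀ p ∈ D i, ∀ q, p ≤ q → q ∈ D i) (hdense : ∀ i p, ∃ q ∈ D i, p ≤ q)
    (p₀ : Node K a) : ∃ q, p₀ ≤ q ∧ ∀ i, q ∈ D i := by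
  obtain ⟨g⟩ := lift_mk_le'.1 hι
  obtain ⟨q, hq, hq'⟩ := exists_mem_forall h hg (D := fun k => {p | ∀ i, g i = k → p ∈ D i})
    (fun k p hp q hpq i hi => hopen i p (hp i hi) q hpq) (fun k p => by
      by_cases hk : ∃ i, g i = k
      · obtain ⟨i, rfl⟩ := hk
        obtain ⟨q, hq, hpq⟩ := hdense i p
        exact ⟨q, fun j hj => g.injective hj ▸ hq, hpq⟩
      · exact ⟨p, fun i hi => absurd ⟨i, hi⟩ hk, le_rfl⟩) p₀
  exact ⟨q, hq, fun i => hq' _ i rfl⟩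

omit [WellFoundedLT K] in
theorem level_lt (h : RegularPair X K) (hg : ClubGuess X K a c) (E : Node K a) :
    level E < (Order.succ #K).ord := by
  rw [Cardinal.lt_ord]
  exact Order.lt_succ_of_le ((card_level_le E).trans
    (mk_le_of_isChain h hg (isTree.isChain_Iio E)))

omit [LinearOrder K] [WellFoundedLT K] in
theorem lift_mk_Iio_le {o : Ordinal.{u}} (ho : o < (Order.succ #K).ord) :
    lift.{u} #(Iio o) ≤ lift.{u + 1} #K := by
  rw [Cardinal.lt_ord, Order.lt_succ_iff] at ho
  rw [mk_Iio_ordinal, lift_lift]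
  exact lift_le.2 ho

theorem exists_le_level (h : RegularPair X K) (hg : ClubGuess X K a c) {α : Ordinal.{u}}
    (hα : α < (Order.succ #K).ord) (E : Node K a) : ∃ F, E ≤ F ∧ α ≤ level F := by
  induction α using WellFoundedLT.induction generalizing E with
  | ind α ih =>
    obtain ⟨F, hF, hF'⟩ := exists_mem_forall_of_lift_le h hg (ι := Iio α) (lift_mk_Iio_le hα)
      (D := fun β => {p | β.1 ≤ level p})
      (fun β p hp q hpq => le_trans (b := level p) hp (level_strictMono.monotone hpq))
      (fun β p => by
        obtain ⟨q, hpq, hq⟩ := ih β.1 β.2 (lt_trans β.2 hα) p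
        exact ⟨q, hq, hpq⟩) E
    -- `F` has level at least every β < α; one more point brings it to level at least α.
    refine ⟨F.snoc F.height le_rfl (h.exists_gt _), hF.trans (lt_snoc _ _ _ _).le,
      not_lt.1 fun hlt => ?_⟩
    exact absurd (hF' ⟨_, hlt⟩) (not_le.2 (level_strictMono (lt_snoc _ _ _ _)))

theorem addsBranch (h : RegularPair X K) (hg : ClubGuess X K a c) :
    AddsBranch (Node K a)ᵒᵈ (Node K a) (Order.succ #K) := by
  refine addsBranch_of_level isTree (fun E F hEF => ?_) (level_lt h hg)
    fun α hα E => exists_le_level h hg hα E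
  have hγ : E.height ≤ F.height := height_mono hEF.le
  refine ⟨E.snoc F.height hγ (h.exists_gt _), (lt_snoc _ _ _ _).le, fun hle => ?_, fun hle => ?_⟩
  · exact lt_irrefl _ (lt_height (mem_of_le hle (Or.inl rfl : F.height ∈ E.snoc F.height hγ _)))
  · refine hEF.not_ge (le_iff.2 fun x => ⟨fun hx => ⟨?_, lt_height hx⟩,
      fun hx => mem_of_le hEF.le hx.1⟩)
    exact (mem_snoc.1 (mem_of_le hle hx)).resolve_left (lt_height hx).ne

theorem addsNoSmallSets (h : RegularPair X K) (hg : ClubGuess X K a c) :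
    AddsNoSmallSets (Node K a)ᵒᵈ (Order.succ #K) := by
  intro Y p A p₁ _ hA p₂ hp₂
  obtain ⟨p₃, hp₃, o, ho⟩ := hA p₂ hp₂
  obtain ⟨p₄, hp₄, F, htotal, hfun, honto⟩ := ho p₃ le_rfl
  have hmono : ∀ {x : Iio o.1} {y : Y} {p q : (Node K a)ᵒᵈ}, q ≤ p → FStmt.mem (x, y) F p →
      FStmt.mem (x, y) F q := fun hqp h r hr => h r (hr.trans hqp)
  obtain ⟨q, hq, hqD⟩ := exists_mem_forall_of_lift_le h hg (ι := Iio o.1) (lift_mk_Iio_le o.2)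
    -- The second alternative, incompatibility with `p₄`, makes the set dense also away from `p₄`.
    (D := fun x => {r | (∃ y, FStmt.mem (x, y) F (OrderDual.toDual r)) ∨
      ∀ s ≥ r, ¬ OrderDual.toDual s ≤ p₄})
    (fun x r hr s hrs => hr.imp (fun ⟨y, hy⟩ => ⟨y, hmono hrs hy⟩)
      fun hr t ht => hr t (le_trans hrs ht))
    (fun x r => by
      by_cases hr : ∃ s ≥ r, OrderDual.toDual s ≤ p₄
      · obtain ⟨s, hs, hs'⟩ := hr
        obtain ⟨t, ht, y, hy⟩ := htotal x (OrderDual.toDual s) hs'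
        exact ⟨OrderDual.ofDual t, Or.inl ⟨y, hy⟩,
          le_trans hs (show s ≤ OrderDual.ofDual t from ht)⟩
      · push Not at hr
        exact ⟨r, Or.inr hr, le_rfl⟩)
    (OrderDual.ofDual p₄)
  have hqp : OrderDual.toDual q ≤ p₄ := hq
  have hex : ∀ x, ∃ y, FStmt.mem (x, y) F (OrderDual.toDual q) := fun x =>
    (hqD x).resolve_right fun hs => hs q le_rfl hqp
  choose g hgF using hex
  refine ⟨OrderDual.toDual q, hqp.trans (hp₄.trans hp₃), range g, fun y => ⟨?_, ?_⟩⟩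
  · intro r hr hy
    obtain ⟨s, hs, x, hx⟩ := (honto y).1 r (hr.trans hqp) hy r le_rfl
    exact ⟨x, hfun x (g x) y s (hs.trans (hr.trans hqp)) (hmono (hs.trans hr) (hgF x)) s le_rfl hx⟩
  · rintro r hr ⟨x, rfl⟩
    exact (honto (g x)).2 r (hr.trans hqp) fun s hs => ⟨s, le_rfl, x, hmono (hs.trans hr) (hgF x)⟩

theorem meetsClosurePoints_of_isStationary (h : RegularPair X K) {I : Type v}
    [LinearOrder I] (φ : I ≃o X) {S : Set I} (hS : IsStationary S) :
    MeetsClosurePoints (φ '' S) := by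
  intro m
  have hclub : IsClub {α | (∃ b, b < φ α) ∧ ∀ x < φ α, m x < φ α} := by
    refine ⟨fun d hd hne _ α hα => ⟨?_, fun x hx => ?_⟩, fun α => ?_⟩
    · obtain ⟨β, hβ⟩ := hne
      obtain ⟨b, hb⟩ := (hd hβ).1
      exact ⟨b, hb.trans_le (φ.monotone (hα.1 hβ))⟩
    · obtain ⟨β, hβ, hxβ⟩ := (lt_isLUB_iff hα).1 (φ.symm_apply_lt.2 hx)
      exact ((hd hβ).2 x (φ.symm_apply_lt.1 hxβ)).trans_le (φ.monotone (hα.1 hβ))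
    · obtain ⟨δ, -, ⟨b, hb⟩, hδ⟩ := h.largeCof_meetsClosurePoints fun x => max (m x) (φ α)
      refine ⟨φ.symm δ, ⟨⟨b, by simpa using hb⟩, fun x hx => ?_⟩, ?_⟩
      · rw [φ.apply_symm_apply] at hx ⊢
        exact (le_max_left _ _).trans_lt (hδ x hx)
      · exact (φ.le_symm_apply).2 ((le_max_right _ _).trans_lt (hδ b hb)).le
  obtain ⟨α, hα, hne, hαm⟩ := hS hclub
  exact ⟨φ α, ⟨α, hα, rfl⟩, hne, hαm⟩

/-- Let Φ extend each condition so that it forces a member of the club name between the old and the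
new height. A node closed under Φ cofinally below a point of `S` forces that point to be a limit of
the club. -/
theorem preservesStationary (h : RegularPair X K) (hg : ClubGuess X K a c) {kap : Cardinal.{u}}
    (φ : Iio kap.ord ≃o X) : PreservesStationary (Node K a)ᵒᵈ kap := by
  intro S hS p C p₁ _ hC p₂ hp₂
  have hmono : ∀ {x : Iio kap.ord} {p q : (Node K a)ᵒᵈ}, q ≤ p → FStmt.mem x C p →
      FStmt.mem x C q := fun hqp h r hr => h r (hr.trans hqp)
  have key : ∀ r : Node K a, ∃ s, r ≤ s ∧ (OrderDual.toDual r ≤ p₂ →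
      ∃ α, FStmt.mem α C (OrderDual.toDual s) ∧ r.height ≤ φ α ∧ φ α < s.height) := by
    intro r
    by_cases hr : OrderDual.toDual r ≤ p₂
    · obtain ⟨t, ht, α, hα, hα'⟩ := hC.1 (φ.symm r.height) _ (hr.trans hp₂)
      have hle : (OrderDual.ofDual t).height ≤ max (OrderDual.ofDual t).height (φ α) :=
        le_max_left _ _
      refine ⟨(OrderDual.ofDual t).snoc _ hle (h.exists_gt _), le_trans
        (show r ≤ OrderDual.ofDual t from ht) (lt_snoc _ _ _ _).le, fun _ => ⟨α, ?_, ?_, ?_⟩⟩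
      · exact hmono (p := t) (lt_snoc _ _ hle (h.exists_gt _)).le hα
      · exact φ.symm_apply_le.1 hα'
      · exact (le_max_right _ _).trans_lt (lt_height (Or.inl rfl))
    · exact ⟨r, le_rfl, fun h => absurd h hr⟩
  choose Φ hΦ hΦC using key
  obtain ⟨_, ⟨δ, hδ, rfl⟩, ⟨b, hb⟩, q, hq, hcl⟩ := exists_closed_node h hg hΦ (OrderDual.ofDual p₂)
    (meetsClosurePoints_of_isStationary h φ hS)
  refine ⟨OrderDual.toDual q, hq, δ, ?_, hδ⟩
  refine hC.2 δ (OrderDual.toDual q) (le_trans (b := p₂) hq hp₂) ⟨⟨φ.symm b, φ.symm_apply_lt.2 hb⟩, ?_⟩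
  intro β q₁ hq₁ hβ q₂ hq₂
  obtain ⟨r, hr, -, hβr, hrδ, hrq⟩ := hcl (φ β) (φ.lt_iff_lt.2 hβ)
  obtain ⟨α, hα, h1, h2⟩ := hΦC r hr
  exact ⟨q₂, le_rfl, α, hmono (hq₂.trans (hq₁.trans hrq)) hα,
    φ.lt_iff_lt.1 (hβr.trans_le h1), φ.lt_iff_lt.1 (h2.trans hrδ)⟩

end Node

end Nodes

/-! ### Instantiation at κ = θ⁺ = 2^θ -/

theorem mk_Iio_ord_toType_lt {c : Cardinal.{u}} (i : c.ord.ToType) : #(Iio i) < c := by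
  simpa using mk_Iio_lt i (by simp)

theorem exists_strict_bound_of_isRegular {c : Cardinal.{u}} (hc : c.IsRegular) (A : Set c.ord.ToType)
    (hA : #A < c) : ∃ b, ∀ a ∈ A, a < b := by
  by_contra hcon
  push Not at hcon
  refine hA.not_ge ?_
  have := Order.cof_le (s := A) hcon
  simpa [hc.cof_ord] using this

theorem regularPair_ord {theta : Cardinal.{u}} (hθ : ℵ₀ ≤ theta) (h2 : Order.succ theta = 2 ^ theta) :
    RegularPair (Order.succ (Order.succ theta)).ord.ToType (Order.succ theta).ord.ToType := by
  have hκ : ℵ₀ ≤ Order.succ theta := hθ.trans (Order.le_succ theta)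
  refine ⟨fun A hA => ?_, fun x => ?_, fun A hA => ?_, fun k => ?_, ?_, fun k => ?_⟩
  · rw [mk_ord_toType] at hA
    exact exists_strict_bound_of_isRegular (isRegular_succ hκ) A (Order.lt_succ_of_le hA)
  · rw [mk_ord_toType]
    exact Order.le_of_lt_succ (mk_Iio_ord_toType_lt x)
  · rw [mk_ord_toType] at hA
    exact exists_strict_bound_of_isRegular (isRegular_succ hθ) A hA
  · rw [mk_ord_toType]
    exact mk_Iio_ord_toType_lt k
  · rw [mk_ord_toType]
    exact Order.lt_succ_of_le hθ
  · have hk : #(Iio k) ≤ theta := Order.le_of_lt_succ (mk_Iio_ord_toType_lt k)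
    rw [mk_ord_toType]
    calc Order.succ theta ^ #(Iio k) ≤ Order.succ theta ^ theta :=
          power_le_power_left (Order.bot_lt_succ theta).ne' hk
      _ = 2 ^ theta := by rw [h2, ← power_mul, mul_eq_self hθ]
      _ = Order.succ theta := h2.symm

theorem existsSemiProperTree_succ {theta : Cardinal.{u}} (hθ : ℵ₀ ≤ theta)
    (h2 : Order.succ theta = 2 ^ theta) :
    ExistsSemiProperTree (Order.succ (Order.succ (Order.succ theta)))
      (Order.succ (Order.succ theta)) := by
  have h := regularPair_ord hθ h2
  obtain ⟨a, c, hg⟩ := exists_clubGuess h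
  have hK : #(Order.succ theta).ord.ToType = Order.succ theta := mk_ord_toType _
  have hX : #(Order.succ (Order.succ theta)).ord.ToType =
      Order.succ #(Order.succ theta).ord.ToType := by rw [mk_ord_toType, mk_ord_toType]
  have htree := Node.isCardTree h hg hX
  have hbranch := Node.addsBranch h hg
  have hsmall := Node.addsNoSmallSets h hg
  rw [hK] at htree hbranch hsmall
  obtain ⟨x, -⟩ := h.bdd ∅ (by simp)
  exact ⟨Node _ a, inferInstance, htree, ⟨Node.empty _ a x⟩, hbranch,
    Node.preservesStationary h hg Ordinal.ToType.mk, hsmall⟩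

theorem proposition3 :
    (∀ kap : Cardinal.{u}, Cardinal.aleph0 ≤ kap →
      (∃ theta : Cardinal.{u}, kap = Order.succ theta ∧ kap = 2 ^ theta) →
      ExistsSemiProperTree (Order.succ (Order.succ kap)) (Order.succ kap)) ∧
    (GCH.{u} → ∀ kap : Cardinal.{u}, Cardinal.aleph0 ≤ kap →
      (∃ theta : Cardinal.{u}, kap = Order.succ theta) →
      ExistsSemiProperTree (Order.succ (Order.succ kap)) (Order.succ kap)) := by
  have haleph : ∀ theta : Cardinal.{u}, ℵ₀ ≤ Order.succ theta → ℵ₀ ≤ theta := by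
    intro theta h
    by_contra hlt
    rw [not_le] at hlt
    exact absurd h (not_le.2 (isSuccLimit_aleph0.succ_lt hlt))
  refine ⟨?_, fun hGCH => ?_⟩
  · rintro _ hκ ⟨theta, rfl, h2⟩
    exact existsSemiProperTree_succ (haleph theta hκ) h2
  · rintro _ hκ ⟨theta, rfl⟩
    exact existsSemiProperTree_succ (haleph theta hκ) (hGCH theta (haleph theta hκ)).symm
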